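/- Let $T>0$, $\mathbb T=\mathbb R/T\mathbb Z$, let $O(\mathbb T)$ be its isometry group, and let $G\subset O(\mathbb T)\times O(3)\times\Sigma_n$ be a subgroup (a \emph{symmetry group}) with projections $\tau,\rho,\sigma$, acting transitively on the indices $\{1,\dots,n\}$ through $\sigma$. Let $m_1,\dots,m_n>0$ be masses with $m_{\sigma(g)i}=m_i$ for $g\in G$, and let $\alpha>0$. A loop is an element $x=(x_1,\dots,x_n)$ of $H^1(\mathbb T,(\mathbb R^3)^n)$; it is $G$-equivariant if $x_{\sigma(g)i}(\tau(g)t)=\rho(g)x_i(t)$ for all $g\in G$, $t$, $i$. For $\omega\in\mathbb R^3$ let \[\mathcal A_\omega(x)=\int_{\mathbb T}\Big(\sum_i\tfrac{m_i}{2}|\dot x_i+\omega\times x_i|^2+\sum_{i<j}m_im_j|x_i-x_j|^{-\alpha}\Big)\,dt\in[0,\infty].\] A vector $v\neq0$ is a \emph{rotation axis} for a symmetry group if each of its elements $g$ satisfies $\rho(g)v=\varepsilon_g v$ with $\varepsilon_g\in\{\pm1\}$ and $\det\tau(g)=\varepsilon_g\det\rho(g)$, where $\det\tau(g)=1$ if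 $\tau(g)$ is a time shift and $-1$ if it is a time reflection. $G$ is \emph{bound to collisions} if every $G$-equivariant loop has a collision ($x_i(t)=x_j(t)$ for some $t$ and some $i\ne j$). $G$ is \emph{fully uncoercive} if for $\omega=0$ and for every rotation axis $\omega$ of $G$, $\mathcal A_\omega$ restricted to the $G$-equivariant loops is not coercive (coercive: $\mathcal A_\omega(x)\to\infty$ as $\|x\|_{H^1}\to\infty$). Let $K=\ker\tau\subset G$ be the core and $H_1\subset G$ the isotropy group of an index (any one) for the permutation action. Assume that $K\neq1$ and that $K$ is not generated by a single plane reflection (an element whose image under $\rho$ is a reflection along a plane). (a) If $G$ is neither bound to collisions nor fully uncoercive, then one and only one of the following holds: $K\cap H_1=1$; $K\cap H_1$ is generated by a single reflection along a plane; $K\cap H_1=K$. (b) Suppose that $K\cap H_1$ is generated by a single element acting on $\mathbb R^3$ as the reflection along a plane $P$. \begin{itemize} \item If $P$ is $K$-invariant, then $\rho(K)$ is conjugate in $O(3)$ to one of: $C_{ph}$ ($p\ge1$), $I\times D_p$ ($p\ge2$ even), $D_pC_p$ ($p\ge2$), $D_{2p}D_p$ ($p\ge1$). If $P$ is not $K$-invariant,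 then $G$ is bound to collisions or fully uncoercive. \item If $\rho(K)$ is of one of the last three types, then neither $K$ nor $G$ has a rotation axis, and $G$ is bound to collisions or fully uncoercive. \item If $\rho(K)$ is of type $C_{ph}$, then every nonzero vector orthogonal to $P$ is a rotation axis for the core $K$. \end{itemize} Here, with $\zeta_p$ the rotation by $2\pi/p$ about the third coordinate axis and $\kappa=\mathrm{diag}(1,-1,-1)$: $I\times D_p=\langle-1,\zeta_p,\kappa\rangle$, $D_pC_p=\langle\zeta_p,-\kappa\rangle$, $D_{2p}D_p=\langle\zeta_p,\kappa,-\zeta_{2p}\rangle$, and $C_{ph}=\langle-1,\zeta_p\rangle$ for $p$ even, $C_{ph}=\langle-\zeta_{2p}\rangle$ for $p$ odd. -/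

import Mathlib

open MeasureTheory
open scoped ENNReal NNReal

namespace NBody

/-! ### Space, time circle, symmetry groups -/

/-- Euclidean three-space. -/
abbrev Space : Type := EuclideanSpace ℝ (Fin 3)

/-- The orthogonal group `O(3)`, as a group of matrices. -/
abbrev O3 : Type := Matrix.orthogonalGroup (Fin 3) ℝ

/-- The orthogonal group of the time circle `ℝ / Tℤ`: the group of its isometries. -/
abbrev TimeO (T : ℝ) : Type := AddCircle T ≃ᵢ AddCircle T

/-- The product `O(𝕋) × O(3) × Σ_n`; its subgroups are the symmetry groups, and the homomorphisms
`τ`, `ρ`, `σ` are the three projections. -/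
abbrev FullGroup (T : ℝ) (n : ℕ) : Type := TimeO T × O3 × Equiv.Perm (Fin n)

section Groups

variable {T : ℝ} {n : ℕ}

/-- The time projection. -/
noncomputable def tau : FullGroup T n →* TimeO T := MonoidHom.fst _ _

/-- The space projection. -/
noncomputable def rho : FullGroup T n →* O3 := (MonoidHom.fst _ _).comp (MonoidHom.snd _ _)

/-- The index projection. -/
noncomputable def sigma : FullGroup T n →* Equiv.Perm (Fin n) := (MonoidHom.snd _ _).comp (MonoidHom.snd _ _)

/-- The action of an orthogonal matrix on a vector of Euclidean space. -/
def spaceAct (A : O3) (v : Space) : Space := WithLp.toLp 2 ((A : Matrix (Fin 3) (Fin 3) ℝ).mulVec v.ofLp)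

/-- The determinant of an isometry of the time circle: `1` for rotations (time shifts) and `-1` for
reflections. -/
noncomputable def timeDet (f : TimeO T) : ℝ :=
  open Classical in if ∃ c : AddCircle T, ∀ t, f t = t + c then 1 else -1

/-- The determinant of an element of `O(3)`. -/
noncomputable def spaceDet (A : O3) : ℝ := (A : Matrix (Fin 3) (Fin 3) ℝ).det

/-- The core `ker τ` of a symmetry group. -/
noncomputable def core (G : Subgroup (FullGroup T n)) : Subgroup (FullGroup T n) := G ⊓ tau.ker

/-- The isotropy subgroup of the index `i` for the permutation action of `G`. -/
noncomputable def isotropy (G : Subgroup (FullGroup T n)) (i : Fin n) : Subgroup (FullGroup T n) :=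
  G ⊓ (MulAction.stabilizer (Equiv.Perm (Fin n)) i).comap sigma

/-- `G` acts transitively on the index set. -/
def IsTransitive (G : Subgroup (FullGroup T n)) : Prop :=
  ∀ i j : Fin n, ∃ g ∈ G, sigma g i = j

/-- `v` is a rotation axis for `G`: the line spanned by `v ≠ 0` is invariant, and `det τ(g)` equals
the determinant of `ρ(g)` on the plane orthogonal to `v`, that is, `det ρ(g)` times the sign `±1` by
which `g` acts on `v`. -/
def IsRotationAxis (G : Subgroup (FullGroup T n)) (v : Space) : Prop :=
  v ≠ 0 ∧ ∀ g ∈ G,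
    (spaceAct (rho g) v = v ∧ timeDet (tau g) = spaceDet (rho g)) ∨
    (spaceAct (rho g) v = -v ∧ timeDet (tau g) = -spaceDet (rho g))

/-- `A` is the reflection along the plane `P`. -/
def IsPlaneReflection (A : O3) (P : Submodule ℝ Space) : Prop :=
  Module.finrank ℝ P = 2 ∧ ∀ v, spaceAct A v = P.reflection v

/-- `N` is generated by a single element, whose space component is the reflection along `P`. -/
def GeneratedByReflection (N : Subgroup (FullGroup T n)) (P : Submodule ℝ Space) : Prop :=
  ∃ s : FullGroup T n, IsPlaneReflection (rho s) P ∧ N = Subgroup.zpowers s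

/-- The subspace `P` is invariant under the space action of `N`. -/
def LeavesInvariant (N : Subgroup (FullGroup T n)) (P : Submodule ℝ Space) : Prop :=
  ∀ g ∈ N, ∀ v ∈ P, spaceAct (rho g) v ∈ P

/-- The image of `N` in `O(3)` is conjugate to `F`. -/
def HasSpaceType (N : Subgroup (FullGroup T n)) (F : Subgroup O3) : Prop :=
  ∃ a : O3, N.map rho = F.map (MulAut.conj a).toMonoidHom

end Groups

/-! ### The finite subgroups of `O(3)` that occur, by their standard generators -/

/-- The rotation of angle `2π / p` around the third axis. -/
noncomputable def zeta (p : ℕ) : O3 :=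
  ⟨!![Real.cos (2 * Real.pi / p), -Real.sin (2 * Real.pi / p), 0;
      Real.sin (2 * Real.pi / p), Real.cos (2 * Real.pi / p), 0;
      0, 0, 1], by
    rw [Matrix.mem_orthogonalGroup_iff]
    have h := Real.sin_sq_add_cos_sq (2 * Real.pi / p)
    ext i j
    fin_cases i <;> fin_cases j <;>
      simp [Matrix.mul_apply, Fin.sum_univ_three] <;> nlinarith [h]⟩

/-- The half-turn around the first axis. -/
def kappa : O3 :=
  ⟨!![1, 0, 0; 0, -1, 0; 0, 0, -1], by
    rw [Matrix.mem_orthogonalGroup_iff]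
    ext i j
    fin_cases i <;> fin_cases j <;>
      simp [Matrix.mul_apply, Fin.sum_univ_three]⟩

/-- The prism group `C_{ph}`: `I × C_p` for even `p` and `C_{2p}C_p` for odd `p`. -/
def groupCph (p : ℕ) : Subgroup O3 :=
  if Even p then Subgroup.closure {-1, zeta p} else Subgroup.closure {-zeta (2 * p)}

/-- The group `I × D_p`, of order `4p`. -/
def groupIDp (p : ℕ) : Subgroup O3 := Subgroup.closure {-1, zeta p, kappa}

/-- The group `D_pC_p`, of order `2p`, generated by plane reflections. -/
def groupDpCp (p : ℕ) : Subgroup O3 := Subgroup.closure {zeta p, -kappa}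

/-- The group `D_{2p}D_p`, of order `4p`. -/
def groupD2pDp (p : ℕ) : Subgroup O3 := Subgroup.closure {zeta p, kappa, -zeta (2 * p)}

/-! ### Loops, the action functional, coercivity -/

section Loops

variable {T : ℝ} [Fact (0 < T)] {n : ℕ}

/-- A loop in `H¹(𝕋, (ℝ³)ⁿ)`: the absolutely continuous representative, together with (a representative
of) its square-integrable derivative, which it determines almost everywhere. -/
structure Loop (T : ℝ) [Fact (0 < T)] (n : ℕ) where
  pos : AddCircle T → Fin n → Space
  vel : AddCircle T → Fin n → Space
  memLp_vel : MemLp vel 2 volume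
  pos_sub : ∀ a b : ℝ, pos (b : AddCircle T) - pos (a : AddCircle T) =
    ∫ s in a..b, vel (s : AddCircle T)

/-- The `H¹`-norm. -/
noncomputable def Loop.h1Norm (x : Loop T n) : ℝ :=
  Real.sqrt (∫ t, ∑ i, (‖x.pos t i‖ ^ 2 + ‖x.vel t i‖ ^ 2))

/-- Equivariance: `x_{σ(g)i}(τ(g)t) = ρ(g) x_i(t)`. -/
def Loop.IsEquivariant (G : Subgroup (FullGroup T n)) (x : Loop T n) : Prop :=
  ∀ g ∈ G, ∀ t i, x.pos (tau g t) (sigma g i) = spaceAct (rho g) (x.pos t i)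

/-- Two bodies occupy the same place at some time. -/
def Loop.HasCollision (x : Loop T n) : Prop :=
  ∃ t, ∃ i j, i ≠ j ∧ x.pos t i = x.pos t j

/-- The cross product with `ω`. -/
def omegaCross (ω v : Space) : Space := WithLp.toLp 2 (crossProduct ω.ofLp v.ofLp)

/-- The Lagrangian action in a frame rotating with angular velocity `ω`, for the masses `m` and the
homogeneous potential of degree `-α`; it may be infinite. -/
noncomputable def Loop.action (m : Fin n → ℝ) (α : ℝ) (ω : Space) (x : Loop T n) : ℝ≥0∞ :=
  ∫⁻ t, (∑ i, ENNReal.ofReal (m i / 2 * ‖x.vel t i + omegaCross ω (x.pos t i)‖ ^ 2) +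
    ∑ i, ∑ j ∈ Finset.Ioi i,
      ENNReal.ofReal (m i * m j) * (ENNReal.ofReal ‖x.pos t i - x.pos t j‖) ^ (-α))

/-- The action tends to infinity with the `H¹`-norm along the `G`-equivariant loops. -/
def IsCoercive (m : Fin n → ℝ) (α : ℝ) (ω : Space) (G : Subgroup (FullGroup T n)) : Prop :=
  ∀ C : ℝ≥0, ∃ R : ℝ, ∀ x : Loop T n, x.IsEquivariant G → R ≤ x.h1Norm →
    (C : ℝ≥0∞) ≤ x.action m α ω

/-- Every `G`-equivariant loop has collisions. -/
def BoundToCollision (G : Subgroup (FullGroup T n)) : Prop :=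
  ∀ x : Loop T n, x.IsEquivariant G → x.HasCollision

/-- For every possible rotation vector (zero or a rotation axis of `G`) the action is not coercive on
the `G`-equivariant loops. -/
def FullyUncoercive (m : Fin n → ℝ) (α : ℝ) (G : Subgroup (FullGroup T n)) : Prop :=
  ∀ ω : Space, (ω = 0 ∨ IsRotationAxis G ω) → ¬ IsCoercive m α ω G

end Loops

/-- The core has type `C_{ph}` for some `p ≥ 1`. -/
def IsTypeCph {T : ℝ} {n : ℕ} (N : Subgroup (FullGroup T n)) : Prop :=
  ∃ p : ℕ, 1 ≤ p ∧ HasSpaceType N (groupCph p)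

/-- The core has type `I × D_p` with `p ≥ 2` even, or `D_pC_p` with `p ≥ 2`, or `D_{2p}D_p` with
`p ≥ 1`. -/
def IsDihedralType {T : ℝ} {n : ℕ} (N : Subgroup (FullGroup T n)) : Prop :=
  (∃ p : ℕ, 2 ≤ p ∧ Even p ∧ HasSpaceType N (groupIDp p)) ∨
  (∃ p : ℕ, 2 ≤ p ∧ HasSpaceType N (groupDpCp p)) ∨
  (∃ p : ℕ, 1 ≤ p ∧ HasSpaceType N (groupD2pDp p))

end NBody

namespace NBody

/-! ### Linear algebra of `O(3)` acting on space -/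

/-! Everything rests on one mechanism, `not_isCoercive`. Integrating an equivariant loop x over time
gives a constant configuration u with the same symmetry, so x + R u is equivariant for every R and
has the velocities of x. If x has no collision, pairs with u_j = u_k keep their separation and the
other pairs move apart, so the potential stays bounded for large R; the kinetic part does not change
if ω × x_j = 0 for all j. If moreover some body stays strictly on one side of a plane through the
origin, then u ≠ 0, and the norm diverges at bounded action.

Fix a collisionless equivariant loop. A core element fixing x_i(t) fixes the index i, since distinct
bodies never meet; in particular the core acts faithfully on space. For (a), let K ∩ H_i be neither
trivial nor K. Then x_i never vanishes and consists of fixed vectors of K ∩ H_i. If x_i leaves a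
line, there are two independent fixed vectors and only one reflection is possible. If it stays on a
line, the mechanism rules out a coercive ω that is zero or on that line; any other ω is multiplied
by det ρ(g), which forces each g to be trivial or the reflection along ω.

For (b), let w be normal to P. A second reflection in K whose normal is not parallel to w makes G
fully uncoercive (`fullyUncoercive_of_reflections`): body i never meets its mirror plane, and a
rotation axis would have to be parallel to both normals. Conjugating the generator yields such a
reflection when P is not invariant; more generally one exists whenever w is not an axis of K. If P
is invariant, ρ(K) is finite, and after making P horizontal it is generated by some ζ_p, the
horizontal mirror and possibly a half-turn conjugated to κ; the parity of p names the group.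
Finally, v is an axis of K exactly when ρ(k)v = det ρ(k) v on K (`axialGroup`). This holds for e₃ in
C_{ph}, and cannot hold for both κ and a nontrivial rotation about e₃. -/

theorem space_ext {a b : Space} (h0 : a 0 = b 0) (h1 : a 1 = b 1) (h2 : a 2 = b 2) : a = b := by
  ext i; fin_cases i <;> assumption

theorem eq_zero_of_eq_neg_self {v : Space} (h : v = -v) : v = 0 := by
  have h2 : (2 : ℝ) • v = 0 := by
    rw [two_smul]; nth_rewrite 1 [h]; exact neg_add_cancel v
  exact (smul_eq_zero.1 h2).resolve_left two_ne_zero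

theorem inner_eq (a b : Space) : inner ℝ a b = a 0 * b 0 + a 1 * b 1 + a 2 * b 2 := by
  simp [PiLp.inner_apply, Fin.sum_univ_three, mul_comm]

theorem spaceAct_apply (A : O3) (v : Space) (i : Fin 3) :
    spaceAct A v i = A.1 i 0 * v 0 + A.1 i 1 * v 1 + A.1 i 2 * v 2 := by
  simp [spaceAct, Matrix.mulVec, dotProduct, Fin.sum_univ_three]

theorem omegaCross_apply_zero (a b : Space) : omegaCross a b 0 = a 1 * b 2 - a 2 * b 1 := by
  simp [omegaCross, cross_apply]

theorem omegaCross_apply_one (a b : Space) : omegaCross a b 1 = a 2 * b 0 - a 0 * b 2 := by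
  simp [omegaCross, cross_apply]

theorem omegaCross_apply_two (a b : Space) : omegaCross a b 2 = a 0 * b 1 - a 1 * b 0 := by
  simp [omegaCross, cross_apply]

/-- The action of an orthogonal matrix as a continuous linear map. -/
noncomputable def spaceActL (A : O3) : Space →L[ℝ] Space :=
  LinearMap.toContinuousLinearMap
    { toFun := spaceAct A
      map_add' := fun v w => by simp [spaceAct, Matrix.mulVec_add]
      map_smul' := fun c v => by simp [spaceAct, Matrix.mulVec_smul] }

theorem spaceAct_add (A : O3) (v w : Space) : spaceAct A (v + w) = spaceAct A v + spaceAct A w :=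
  map_add (spaceActL A) v w

theorem spaceAct_sub (A : O3) (v w : Space) : spaceAct A (v - w) = spaceAct A v - spaceAct A w :=
  map_sub (spaceActL A) v w

theorem spaceAct_neg (A : O3) (v : Space) : spaceAct A (-v) = -spaceAct A v :=
  map_neg (spaceActL A) v

theorem spaceAct_smul (A : O3) (c : ℝ) (v : Space) : spaceAct A (c • v) = c • spaceAct A v :=
  map_smul (spaceActL A) c v

theorem spaceAct_zero (A : O3) : spaceAct A 0 = 0 := map_zero (spaceActL A)

theorem spaceAct_one (v : Space) : spaceAct 1 v = v := by simp [spaceAct]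

theorem spaceAct_mul (A B : O3) (v : Space) : spaceAct (A * B) v = spaceAct A (spaceAct B v) := by
  simp [spaceAct, Matrix.mulVec_mulVec]

theorem spaceAct_inv_act (A : O3) (v : Space) : spaceAct A⁻¹ (spaceAct A v) = v := by
  rw [← spaceAct_mul, inv_mul_cancel, spaceAct_one]

theorem spaceAct_act_inv (A : O3) (v : Space) : spaceAct A (spaceAct A⁻¹ v) = v := by
  rw [← spaceAct_mul, mul_inv_cancel, spaceAct_one]

theorem spaceAct_ne_zero (A : O3) {v : Space} (hv : v ≠ 0) : spaceAct A v ≠ 0 := fun h =>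
  hv (by rw [← spaceAct_inv_act A v, h, spaceAct_zero])

theorem O3_ext {A B : O3} (h : ∀ v, spaceAct A v = spaceAct B v) : A = B := by
  apply Subtype.ext
  ext i j
  have := congrArg (fun w : Space => w i) (h (EuclideanSpace.single j 1))
  simpa [spaceAct] using this

theorem transpose_mul_self (A : O3) : A.1.transpose * A.1 = 1 := by
  have := A.2
  rw [Matrix.mem_orthogonalGroup_iff'] at this
  exact this

theorem spaceAct_inner (A : O3) (v w : Space) :
    inner ℝ (spaceAct A v) (spaceAct A w) = inner ℝ v w := by
  have h := transpose_mul_self A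
  have e : ∀ i j, A.1 0 i * A.1 0 j + A.1 1 i * A.1 1 j + A.1 2 i * A.1 2 j =
      (1 : Matrix (Fin 3) (Fin 3) ℝ) i j := fun i j => by
    rw [← h]; simp [Matrix.mul_apply, Fin.sum_univ_three]
  have e00 := e 0 0; have e01 := e 0 1; have e02 := e 0 2
  have e11 := e 1 1; have e12 := e 1 2; have e22 := e 2 2
  simp at e00 e01 e02 e11 e12 e22
  simp only [inner_eq, spaceAct_apply]
  linear_combination (v 0 * w 0) * e00 + (v 1 * w 1) * e11 + (v 2 * w 2) * e22 +
    (v 0 * w 1 + v 1 * w 0) * e01 + (v 0 * w 2 + v 2 * w 0) * e02 + (v 1 * w 2 + v 2 * w 1) * e12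

theorem spaceAct_norm (A : O3) (v : Space) : ‖spaceAct A v‖ = ‖v‖ := by
  rw [@norm_eq_sqrt_real_inner _ _ _ (spaceAct A v), spaceAct_inner, ← norm_eq_sqrt_real_inner]

theorem spaceDet_eq (A : O3) : spaceDet A = 1 ∨ spaceDet A = -1 := by
  have h := congrArg Matrix.det (transpose_mul_self A)
  rw [Matrix.det_mul, Matrix.det_transpose, Matrix.det_one] at h
  exact mul_self_eq_one_iff.1 h

theorem spaceDet_mul (A B : O3) : spaceDet (A * B) = spaceDet A * spaceDet B := by
  simp [spaceDet, Matrix.det_mul]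

theorem spaceDet_one : spaceDet 1 = 1 := by simp [spaceDet]

theorem spaceDet_inv (A : O3) : spaceDet A⁻¹ = spaceDet A := by
  have h : spaceDet A⁻¹ * spaceDet A = 1 := by rw [← spaceDet_mul, inv_mul_cancel, spaceDet_one]
  rcases spaceDet_eq A with h' | h' <;> rw [h'] at h ⊢ <;> linarith

theorem spaceDet_conj (a A : O3) : spaceDet (a * A * a⁻¹) = spaceDet A := by
  rw [spaceDet_mul, spaceDet_mul, spaceDet_inv]
  rcases spaceDet_eq a with h | h <;> rw [h] <;> ring

/-- The triple product is the determinant of three columns, hence multiplicative. -/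
theorem triple_spaceAct (A : O3) (a b c : Space) :
    inner ℝ (omegaCross (spaceAct A a) (spaceAct A b)) (spaceAct A c) =
      spaceDet A * inner ℝ (omegaCross a b) c := by
  simp only [inner_eq, omegaCross_apply_zero, omegaCross_apply_one, omegaCross_apply_two,
    spaceAct_apply, spaceDet, Matrix.det_fin_three]
  ring

/-- Orthogonal maps respect the cross product up to their determinant. -/
theorem omegaCross_spaceAct (A : O3) (a b : Space) :
    omegaCross (spaceAct A a) (spaceAct A b) = spaceDet A • spaceAct A (omegaCross a b) := by
  refine ext_inner_right ℝ fun c => ?_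
  rw [← spaceAct_act_inv A c, triple_spaceAct, real_inner_smul_left, spaceAct_inner]

theorem inner_omegaCross_left (a b : Space) : inner ℝ a (omegaCross a b) = 0 := by
  simp only [inner_eq, omegaCross_apply_zero, omegaCross_apply_one, omegaCross_apply_two]; ring

theorem inner_omegaCross_right (a b : Space) : inner ℝ b (omegaCross a b) = 0 := by
  simp only [inner_eq, omegaCross_apply_zero, omegaCross_apply_one, omegaCross_apply_two]; ring

theorem omegaCross_anticomm (a b : Space) : omegaCross a b = -omegaCross b a := by
  apply space_ext <;>
    simp [omegaCross_apply_zero, omegaCross_apply_one, omegaCross_apply_two] <;> ring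

theorem omegaCross_self (a : Space) : omegaCross a a = 0 := by
  apply space_ext <;>
    simp [omegaCross_apply_zero, omegaCross_apply_one, omegaCross_apply_two] <;> ring

/-- Cramer's rule in the basis `a, b, a × b`. -/
theorem cramer (a b v : Space) :
    (inner ℝ (omegaCross a b) (omegaCross a b) : ℝ) • v =
      (inner ℝ (omegaCross v b) (omegaCross a b) : ℝ) • a +
      (inner ℝ (omegaCross a v) (omegaCross a b) : ℝ) • b +
      (inner ℝ (omegaCross a b) v : ℝ) • omegaCross a b := by
  apply space_ext <;>
    simp only [inner_eq, omegaCross_apply_zero, omegaCross_apply_one, omegaCross_apply_two,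
      PiLp.smul_apply, PiLp.add_apply, smul_eq_mul] <;> ring

/-- This is the expansion of e × (e × v). -/
theorem smul_eq_of_omegaCross_eq_zero {e v : Space} (h : omegaCross e v = 0) :
    (inner ℝ e e : ℝ) • v = (inner ℝ e v : ℝ) • e := by
  have h0 := congrArg (fun w : Space => w 0) h
  have h1 := congrArg (fun w : Space => w 1) h
  have h2 := congrArg (fun w : Space => w 2) h
  simp only [omegaCross_apply_zero, omegaCross_apply_one, omegaCross_apply_two,
    PiLp.zero_apply] at h0 h1 h2
  apply space_ext <;> simp only [inner_eq, PiLp.smul_apply, smul_eq_mul]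
  · linear_combination e 2 * h1 - e 1 * h2
  · linear_combination e 0 * h2 - e 2 * h0
  · linear_combination e 1 * h0 - e 0 * h1

theorem eq_smul_of_omegaCross_eq_zero {e v : Space} (he : e ≠ 0) (h : omegaCross e v = 0) :
    ∃ c : ℝ, v = c • e := by
  refine ⟨(inner ℝ e e)⁻¹ * inner ℝ e v, ?_⟩
  rw [mul_smul, ← smul_eq_of_omegaCross_eq_zero h,
    inv_smul_smul₀ (inner_self_ne_zero.2 he)]

theorem omegaCross_smul_right (c : ℝ) (a b : Space) : omegaCross a (c • b) = c • omegaCross a b := by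
  simp [omegaCross]

theorem omegaCross_smul_left (c : ℝ) (a b : Space) : omegaCross (c • a) b = c • omegaCross a b := by
  simp [omegaCross]

theorem omegaCross_add_right (a b c : Space) :
    omegaCross a (b + c) = omegaCross a b + omegaCross a c := by
  simp [omegaCross]

theorem omegaCross_zero_left (a : Space) : omegaCross 0 a = 0 := by simp [omegaCross]

/-- `A` changes the sign of `w ≠ 0` and fixes its orthogonal complement. -/
def IsReflectionAlong (A : O3) (w : Space) : Prop :=
  w ≠ 0 ∧ spaceAct A w = -w ∧ ∀ v, inner ℝ w v = (0 : ℝ) → spaceAct A v = v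

theorem spaceAct_eq_of_basis {A B : O3} {a b : Space} (hab : omegaCross a b ≠ 0)
    (ha : spaceAct A a = spaceAct B a) (hb : spaceAct A b = spaceAct B b)
    (hw : spaceAct A (omegaCross a b) = spaceAct B (omegaCross a b)) : A = B := by
  refine O3_ext fun v => smul_right_injective Space (inner_self_ne_zero (𝕜 := ℝ).2 hab) ?_
  simp only
  rw [← spaceAct_smul, ← spaceAct_smul, cramer]
  simp only [spaceAct_add, spaceAct_smul, ha, hb, hw]

/-- The vector a × b completes the basis and is multiplied by det A, so the determinant alone
decides between the two cases. -/
theorem eq_one_or_isReflectionAlong {A : O3} {a b : Space} (hab : omegaCross a b ≠ 0)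
    (ha : spaceAct A a = a) (hb : spaceAct A b = b) :
    A = 1 ∨ IsReflectionAlong A (omegaCross a b) := by
  have h := omegaCross_spaceAct A a b
  rw [ha, hb] at h
  rcases spaceDet_eq A with hd | hd <;> rw [hd] at h
  · left
    rw [one_smul] at h
    exact spaceAct_eq_of_basis hab (by rw [ha, spaceAct_one]) (by rw [hb, spaceAct_one])
      (by rw [← h, spaceAct_one])
  · right
    rw [neg_smul, one_smul] at h
    refine ⟨hab, by rw [h, neg_neg, ← h], fun v hv => ?_⟩
    have hc := cramer a b v
    rw [hv, zero_smul, add_zero] at hc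
    refine smul_right_injective Space (inner_self_ne_zero (𝕜 := ℝ).2 hab) ?_
    simp only
    rw [← spaceAct_smul, hc]
    simp only [spaceAct_add, spaceAct_smul, ha, hb]

theorem IsReflectionAlong.eq {A B : O3} {w : Space} (hA : IsReflectionAlong A w)
    (hB : IsReflectionAlong B w) : A = B := by
  refine O3_ext fun v => ?_
  have hw : (inner ℝ w w : ℝ) ≠ 0 := inner_self_ne_zero.2 hA.1
  have h0 : inner ℝ w (v - ((inner ℝ w v : ℝ) / inner ℝ w w) • w) = (0 : ℝ) := by
    rw [inner_sub_right, real_inner_smul_right]; field_simp; ring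
  have h1 := hA.2.2 _ h0
  have h2 := hB.2.2 _ h0
  rw [spaceAct_sub, spaceAct_smul, hA.2.1] at h1
  rw [spaceAct_sub, spaceAct_smul, hB.2.1] at h2
  exact sub_left_injective (h1.trans h2.symm)

theorem IsReflectionAlong.mul_self {A : O3} {w : Space} (h : IsReflectionAlong A w) : A * A = 1 := by
  refine O3_ext fun v => ?_
  have hw : (inner ℝ w w : ℝ) ≠ 0 := inner_self_ne_zero.2 h.1
  have h0 : inner ℝ w (v - ((inner ℝ w v : ℝ) / inner ℝ w w) • w) = (0 : ℝ) := by
    rw [inner_sub_right, real_inner_smul_right]; field_simp; ring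
  have h1 := h.2.2 _ h0
  rw [spaceAct_sub, spaceAct_smul, h.2.1, sub_eq_iff_eq_add] at h1
  rw [spaceAct_mul, spaceAct_one, h1]
  simp only [spaceAct_add, spaceAct_sub, spaceAct_smul, spaceAct_neg, h.2.1, h1]
  simp

theorem IsReflectionAlong.ne_one {A : O3} {w : Space} (h : IsReflectionAlong A w) : A ≠ 1 := by
  rintro rfl
  have := h.2.1
  rw [spaceAct_one] at this
  exact h.1 (eq_zero_of_eq_neg_self this)

theorem IsReflectionAlong.smul {A : O3} {w : Space} (h : IsReflectionAlong A w) {c : ℝ}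
    (hc : c ≠ 0) : IsReflectionAlong A (c • w) := by
  refine ⟨smul_ne_zero hc h.1, by rw [spaceAct_smul, h.2.1, smul_neg], fun v hv => h.2.2 v ?_⟩
  rw [real_inner_smul_left] at hv
  exact (mul_eq_zero.1 hv).resolve_left hc

theorem IsReflectionAlong.conj {A : O3} {w : Space} (h : IsReflectionAlong A w) (B : O3) :
    IsReflectionAlong (B * A * B⁻¹) (spaceAct B w) := by
  refine ⟨spaceAct_ne_zero B h.1, ?_, fun v hv => ?_⟩
  · rw [spaceAct_mul, spaceAct_mul, spaceAct_inv_act, h.2.1, spaceAct_neg]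
  · rw [spaceAct_mul, spaceAct_mul, h.2.2, spaceAct_act_inv]
    rw [← spaceAct_inner B, spaceAct_act_inv, hv]

theorem exists_orthogonal_ne_zero (w : Space) :
    ∃ a : Space, a ≠ 0 ∧ inner ℝ w a = (0 : ℝ) := by
  by_cases h : w 0 = 0
  · refine ⟨EuclideanSpace.single 0 1, ?_, ?_⟩
    · simp
    · simp [inner_eq, h]
  · refine ⟨!₂[-w 1, w 0, 0], fun h' => h ?_, ?_⟩
    · simpa using congrArg (fun v : Space => v 1) h'
    · simp [inner_eq]; ring

theorem omegaCross_ne_zero_of_orthogonal {a b : Space} (ha : a ≠ 0) (hb : b ≠ 0)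
    (h : inner ℝ a b = (0 : ℝ)) : omegaCross a b ≠ 0 := by
  intro h'
  have := smul_eq_of_omegaCross_eq_zero h'
  rw [h, zero_smul, smul_eq_zero, inner_self_eq_zero] at this
  exact this.elim ha hb

theorem IsReflectionAlong.spaceDet_eq {A : O3} {w : Space} (h : IsReflectionAlong A w) :
    spaceDet A = -1 := by
  obtain ⟨a, ha, hwa⟩ := exists_orthogonal_ne_zero w
  have h1 := omegaCross_spaceAct A w a
  rw [h.2.1, h.2.2 a hwa, h.2.2 _ (inner_omegaCross_left w a), ← neg_one_smul ℝ w,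
    omegaCross_smul_left] at h1
  exact (smul_left_injective ℝ (omegaCross_ne_zero_of_orthogonal h.1 ha hwa) h1).symm

/-- Two reflections that agree are along the same line. -/
theorem IsReflectionAlong.exists_smul {A : O3} {w w' : Space} (h : IsReflectionAlong A w)
    (h' : IsReflectionAlong A w') : ∃ c : ℝ, c ≠ 0 ∧ w' = c • w := by
  have h0 : omegaCross w w' = 0 := by
    have := omegaCross_spaceAct A w w'
    rw [h.2.1, h'.2.1, h.2.2 _ (inner_omegaCross_left w w'), h.spaceDet_eq, ← neg_one_smul ℝ w,
      ← neg_one_smul ℝ w', omegaCross_smul_left, omegaCross_smul_right, smul_smul] at this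
    simp only [neg_mul_neg, one_mul, one_smul, neg_smul] at this
    exact eq_zero_of_eq_neg_self this
  obtain ⟨c, hc⟩ := eq_smul_of_omegaCross_eq_zero h.1 h0
  exact ⟨c, fun h1 => h'.1 (by rw [hc, h1, zero_smul]), hc⟩

/-- An orthogonal map of determinant `-1` with a fixed vector is a reflection. -/
theorem exists_isReflectionAlong {A : O3} {n : Space} (hn : n ≠ 0) (hA : spaceAct A n = n)
    (hd : spaceDet A = -1) : ∃ w, inner ℝ n w = (0 : ℝ) ∧ IsReflectionAlong A w := by
  -- Since A + 1 = (1 + Aᵀ) A and det A = -1, this determinant equals its own negative, so -1 is an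
  -- eigenvalue.
  have hdet : Matrix.det (A.1 + 1) = 0 := by
    have h1 : A.1 + 1 = (1 + A.1.transpose).transpose := by simp [add_comm]
    have h2 : (1 + A.1.transpose) * A.1 = A.1 + 1 := by
      rw [add_mul, one_mul, transpose_mul_self]
    have h3 : Matrix.det (A.1 + 1) = Matrix.det (A.1 + 1) * Matrix.det A.1 := by
      conv_lhs => rw [← h2, Matrix.det_mul, ← Matrix.det_transpose, ← h1]
    have h4 : Matrix.det A.1 = -1 := hd
    rw [h4] at h3; linarith
  obtain ⟨v, hv, hAv⟩ := Matrix.exists_mulVec_eq_zero_iff.2 hdet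
  set w : Space := WithLp.toLp 2 v with hw
  have hw0 : w ≠ 0 := fun h => hv (by simpa [hw] using h)
  have hAw : spaceAct A w = -w := by
    rw [Matrix.add_mulVec, Matrix.one_mulVec] at hAv
    have : spaceAct A w + w = 0 := by
      have := congrArg (WithLp.toLp 2 : (Fin 3 → ℝ) → Space) hAv
      simpa [spaceAct, hw] using this
    exact eq_neg_of_add_eq_zero_left this
  have hnw : inner ℝ n w = (0 : ℝ) := by
    have := spaceAct_inner A n w
    rw [hA, hAw, inner_neg_right] at this; linarith
  refine ⟨w, hnw, hw0, hAw, fun x hx => ?_⟩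
  have hc := omegaCross_ne_zero_of_orthogonal hn hw0 hnw
  have hu : spaceAct A (omegaCross n w) = omegaCross n w := by
    have := omegaCross_spaceAct A n w
    rw [hA, hAw, hd, ← neg_one_smul ℝ w, omegaCross_smul_right] at this
    exact (smul_right_injective Space (by norm_num : (-1 : ℝ) ≠ 0) this).symm
  have hnu := omegaCross_ne_zero_of_orthogonal hn hc (inner_omegaCross_left n w)
  refine ((eq_one_or_isReflectionAlong hnu hA hu).resolve_left ?_).2.2 x ?_
  · rintro rfl
    rw [spaceDet_one] at hd; norm_num at hd
  · have h0 : omegaCross w (omegaCross n (omegaCross n w)) = 0 := by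
      have e : inner ℝ n w = n 0 * w 0 + n 1 * w 1 + n 2 * w 2 := inner_eq n w
      rw [hnw] at e
      apply space_ext <;>
        simp only [omegaCross_apply_zero, omegaCross_apply_one, omegaCross_apply_two,
          PiLp.zero_apply]
      · linear_combination (w 1 * n 2 - w 2 * n 1) * (-e)
      · linear_combination (w 2 * n 0 - w 0 * n 2) * (-e)
      · linear_combination (w 0 * n 1 - w 1 * n 0) * (-e)
    obtain ⟨c, hc'⟩ := eq_smul_of_omegaCross_eq_zero hw0 h0
    rw [hc', real_inner_smul_left, hx, mul_zero]

instance : Fact (Module.finrank ℝ Space = 2 + 1) := ⟨by simp⟩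

/-- Passing from the plane to a normal vector allows all later arguments to use cross products. -/
theorem isPlaneReflection_iff {A : O3} {P : Submodule ℝ Space} :
    IsPlaneReflection A P ↔ ∃ w, P = (ℝ ∙ w)ᗮ ∧ IsReflectionAlong A w := by
  constructor
  · rintro ⟨hP, h⟩
    have h1 : Module.finrank ℝ Pᗮ = 1 := by
      have := P.finrank_add_finrank_orthogonal
      rw [hP] at this
      simp at this; omega
    obtain ⟨w, hw, hw'⟩ := finrank_eq_one_iff'.1 h1
    have hPw : Pᗮ = ℝ ∙ (w : Space) := by
      refine le_antisymm (fun v hv => ?_) ((Submodule.span_singleton_le_iff_mem _ _).2 w.2)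
      obtain ⟨c, hc⟩ := hw' ⟨v, hv⟩
      exact Submodule.mem_span_singleton.2 ⟨c, congrArg Subtype.val hc⟩
    have hP' : P = (ℝ ∙ (w : Space))ᗮ := by rw [← hPw, Submodule.orthogonal_orthogonal]
    refine ⟨w, hP', fun h0 => hw (Subtype.ext h0), ?_, fun v hv => ?_⟩
    · rw [h, Submodule.reflection_mem_subspace_orthogonalComplement_eq_neg w.2]
    · rw [h, Submodule.reflection_mem_subspace_eq_self]
      rw [hP', Submodule.mem_orthogonal_singleton_iff_inner_right]; exact hv
  · rintro ⟨w, rfl, hw, hAw, hA⟩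
    refine ⟨Submodule.finrank_orthogonal_span_singleton hw, fun v => ?_⟩
    obtain ⟨y, hy, z, hz, rfl⟩ :=
      (ℝ ∙ w).exists_add_mem_mem_orthogonal (v := v)
    obtain ⟨c, rfl⟩ := Submodule.mem_span_singleton.1 hy
    rw [spaceAct_add, spaceAct_smul, hAw, map_add, map_smul,
      Submodule.reflection_orthogonalComplement_singleton_eq_neg,
      Submodule.reflection_mem_subspace_eq_self hz,
      hA z (Submodule.mem_orthogonal_singleton_iff_inner_right.1 hz)]

section TimeCircle

variable {T : ℝ}

/-! ### Isometries of the time circle -/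

theorem exists_coe_eq_abs_eq_norm (t : AddCircle T) : ∃ a : ℝ, (a : AddCircle T) = t ∧ |a| = ‖t‖ := by
  obtain ⟨a, rfl⟩ := QuotientAddGroup.mk_surjective t
  refine ⟨a - round (T⁻¹ * a) * T, ?_, (AddCircle.norm_eq T).symm⟩
  have : ((round (T⁻¹ * a) * T : ℝ) : AddCircle T) = 0 := by
    rw [← zsmul_eq_mul]; exact AddCircle.coe_eq_zero_iff T |>.2 ⟨_, rfl⟩
  rw [AddCircle.coe_sub, this, sub_zero]

/-- The norm on the circle is the absolute value of the representative nearest to 0. -/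
theorem eq_or_eq_neg_of_norm_eq {s t : AddCircle T} (h : ‖s‖ = ‖t‖) : s = t ∨ s = -t := by
  obtain ⟨a, rfl, ha⟩ := exists_coe_eq_abs_eq_norm s
  obtain ⟨b, rfl, hb⟩ := exists_coe_eq_abs_eq_norm t
  rcases abs_eq_abs.1 (ha.trans (h.trans hb.symm)) with h | h
  · left; rw [h]
  · right; rw [h, AddCircle.coe_neg]

/-- The isometries of the circle are the shifts and the reflections. -/
theorem timeO_eq (f : TimeO T) :
    (∀ t, f t = t + f 0) ∨ (∀ t, f t = -t + f 0) := by
  have h : ∀ t, f t - f 0 = t ∨ f t - f 0 = -t := fun t => by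
    refine eq_or_eq_neg_of_norm_eq ?_
    rw [← dist_eq_norm, f.dist_eq, dist_zero_right]
  by_contra hc
  push Not at hc
  obtain ⟨⟨s, hs⟩, t, ht⟩ := hc
  have hs' := (h s).resolve_left fun h => hs (sub_eq_iff_eq_add.1 h)
  have ht' := (h t).resolve_right fun h => ht (sub_eq_iff_eq_add.1 h)
  -- The sign may at first depend on the point. With opposite signs at s and t, preservation of
  -- their distance gives 2t = 0 or 2s = 0, and then both signs describe the same value at that
  -- point.
  have hn : ‖s + t‖ = ‖s - t‖ := by
    rw [← dist_eq_norm s t, ← f.dist_eq, dist_eq_norm, ← sub_sub_sub_cancel_right _ _ (f 0), hs',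
      ht', ← norm_neg]
    congr 1; abel
  rcases eq_or_eq_neg_of_norm_eq hn with h1 | h1
  · refine ht (sub_eq_iff_eq_add.1 (ht'.trans ?_))
    have : t + t = 0 := by
      have h2 : s + t - (s - t) = 0 := sub_eq_zero.2 h1
      rw [← h2]; abel
    exact eq_neg_of_add_eq_zero_left this
  · refine hs (sub_eq_iff_eq_add.1 (hs'.trans ?_))
    have : s + s = 0 := by
      have h2 : s + t - -(s - t) = 0 := sub_eq_zero.2 h1
      rw [← h2]; abel
    exact (eq_neg_of_add_eq_zero_left this).symm

theorem measurePreserving_timeO [Fact (0 < T)] (f : TimeO T) : MeasurePreserving f := by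
  rcases timeO_eq f with h | h
  · have : (f : AddCircle T → AddCircle T) = fun t => t + f 0 := funext h
    rw [this]; exact measurePreserving_add_right _ _
  · have : (f : AddCircle T → AddCircle T) = fun t => -t + f 0 := funext h
    rw [this]
    exact (measurePreserving_add_right _ _).comp (Measure.measurePreserving_neg _)

theorem timeDet_one : timeDet (1 : TimeO T) = 1 := by
  unfold timeDet
  exact if_pos ⟨0, fun t => by simp⟩

end TimeCircle

section Loops

variable {T : ℝ} [Fact (0 < T)] {n : ℕ}

/-! ### Loops -/

theorem Loop.integrable_vel (x : Loop T n) : Integrable x.vel :=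
  x.memLp_vel.integrable (by norm_num)

theorem Loop.intervalIntegrable_vel (x : Loop T n) (a b : ℝ) :
    IntervalIntegrable (fun s : ℝ => x.vel (s : AddCircle T)) volume a b := by
  have hT : 0 < T := Fact.out
  have hp : Function.Periodic (fun s : ℝ => x.vel (s : AddCircle T)) T := fun s => by simp
  refine hp.intervalIntegrable (t := 0) hT.ne' ?_ a b
  rw [intervalIntegrable_iff_integrableOn_Ioc_of_le (by linarith)]
  exact ((AddCircle.measurePreserving_mk T 0).integrable_comp
    x.integrable_vel.aestronglyMeasurable).2 x.integrable_vel

theorem Loop.continuous_pos (x : Loop T n) : Continuous x.pos := by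
  have h : Continuous fun b : ℝ => x.pos (b : AddCircle T) := by
    have : (fun b : ℝ => x.pos (b : AddCircle T)) = fun b : ℝ =>
        (∫ s in (0 : ℝ)..b, x.vel (s : AddCircle T)) + x.pos ((0 : ℝ) : AddCircle T) := by
      funext b
      rw [← x.pos_sub 0 b, sub_add_cancel]
    rw [this]
    exact (intervalIntegral.continuous_primitive x.intervalIntegrable_vel 0).add continuous_const
  exact isQuotientMap_quotient_mk'.continuous_iff.2 h

theorem Loop.continuous_pos_apply (x : Loop T n) (i : Fin n) : Continuous fun t => x.pos t i :=
  (continuous_apply i).comp x.continuous_pos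

theorem Loop.integrable_pos (x : Loop T n) (i : Fin n) : Integrable fun t => x.pos t i :=
  (x.continuous_pos_apply i).integrable_of_hasCompactSupport
    (HasCompactSupport.of_compactSpace _)

theorem Loop.memLp_vel_apply (x : Loop T n) (i : Fin n) :
    MemLp (fun t => x.vel t i) 2 volume :=
  (memLp_pi_iff.1 x.memLp_vel) i

/-- The mean position. -/
noncomputable def Loop.mean (x : Loop T n) (i : Fin n) : Space := ∫ t, x.pos t i

/-- Time isometries preserve the measure, so τ(g) drops out under the integral. -/
theorem Loop.mean_equivariant {G : Subgroup (FullGroup T n)} {x : Loop T n}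
    (hx : x.IsEquivariant G) {g : FullGroup T n} (hg : g ∈ G) (i : Fin n) :
    x.mean (sigma g i) = spaceAct (rho g) (x.mean i) := by
  have h1 : ∫ t, x.pos (tau g t) (sigma g i) = x.mean (sigma g i) :=
    (measurePreserving_timeO (tau g)).integral_comp
      (tau g).toHomeomorph.measurableEmbedding (fun t => x.pos t (sigma g i))
  rw [← h1]
  simp only [hx g hg]
  exact (spaceActL (rho g)).integral_comp_comm (x.integrable_pos i)

/-- The cross product by a fixed vector as a continuous linear map. -/
noncomputable def omegaCrossL (ω : Space) : Space →L[ℝ] Space :=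
  LinearMap.toContinuousLinearMap
    { toFun := omegaCross ω
      map_add' := omegaCross_add_right ω
      map_smul' := fun c v => omegaCross_smul_right c ω v }

theorem omegaCrossL_apply (ω v : Space) : omegaCrossL ω v = omegaCross ω v := rfl

theorem Loop.omegaCross_mean {x : Loop T n} {ω : Space} {i : Fin n}
    (h : ∀ t, omegaCross ω (x.pos t i) = 0) : omegaCross ω (x.mean i) = 0 := by
  have := (omegaCrossL ω).integral_comp_comm (x.integrable_pos i)
  simp only [omegaCrossL_apply, h, integral_zero] at this
  exact this.symm

/-- The circle is connected, so a continuous function without zeros has constant sign. -/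
theorem integral_ne_zero_of_forall_ne_zero {f : AddCircle T → ℝ} (hf : Continuous f)
    (h : ∀ t, f t ≠ 0) : ∫ t, f t ≠ 0 := by
  have key : ∀ g : AddCircle T → ℝ, Continuous g → (∀ t, 0 < g t) → 0 < ∫ t, g t := by
    intro g hg hpos
    rw [integral_pos_iff_support_of_nonneg (fun t => (hpos t).le)
      (hg.integrable_of_hasCompactSupport (HasCompactSupport.of_compactSpace _))]
    have : Function.support g = Set.univ := Set.eq_univ_of_forall fun t => (hpos t).ne'
    rw [this]
    exact isOpen_univ.measure_pos _ ⟨0, trivial⟩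
  by_cases h0 : 0 < f 0
  · refine (key f hf fun t => ?_).ne'
    by_contra ht
    obtain ⟨s, hs⟩ := mem_range_of_exists_le_of_exists_ge hf ⟨t, not_lt.1 ht⟩ ⟨0, h0.le⟩
    exact h s hs
  · have := key (fun t => -f t) hf.neg fun t => by
      by_contra ht
      obtain ⟨s, hs⟩ := mem_range_of_exists_le_of_exists_ge hf ⟨0, not_lt.1 h0⟩
        ⟨t, by linarith [not_lt.1 ht]⟩
      exact h s hs
    rw [integral_neg] at this
    linarith

theorem Loop.mean_ne_zero {x : Loop T n} {v : Space} {i : Fin n}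
    (h : ∀ t, inner ℝ (x.pos t i) v ≠ (0 : ℝ)) : x.mean i ≠ 0 := by
  intro h0
  refine integral_ne_zero_of_forall_ne_zero (f := fun t => inner ℝ v (x.pos t i))
    (continuous_const.inner (x.continuous_pos_apply i))
    (fun t => by rw [real_inner_comm]; exact h t) ?_
  rw [integral_inner (x.integrable_pos i) v]
  change inner ℝ v (x.mean i) = 0
  rw [h0, inner_zero_right]

/-- The translate of a loop by a constant configuration. -/
noncomputable def Loop.translate (x : Loop T n) (u : Fin n → Space) : Loop T n where
  pos t := x.pos t + u
  vel := x.vel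
  memLp_vel := x.memLp_vel
  pos_sub a b := by rw [add_sub_add_right_eq_sub, x.pos_sub]

theorem Loop.exists_bound (x : Loop T n) (i : Fin n) : ∃ C, ∀ t, ‖x.pos t i‖ ≤ C := by
  obtain ⟨C, hC⟩ := isCompact_univ.exists_bound_of_continuousOn
    (x.continuous_pos_apply i).continuousOn
  exact ⟨C, fun t => hC t trivial⟩

theorem Loop.integrable_sq (x : Loop T n) (i : Fin n) :
    Integrable fun t => ‖x.pos t i‖ ^ 2 + ‖x.vel t i‖ ^ 2 := by
  refine Integrable.add ?_ ((x.memLp_vel_apply i).integrable_norm_pow two_ne_zero)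
  exact ((x.continuous_pos_apply i).norm.pow 2).integrable_of_hasCompactSupport
    (HasCompactSupport.of_compactSpace _)

theorem Loop.le_h1Norm {x : Loop T n} {i : Fin n} {c : ℝ} (hc : 0 ≤ c)
    (h : ∀ t, c ≤ ‖x.pos t i‖) : Real.sqrt T * c ≤ x.h1Norm := by
  have hT : 0 < T := Fact.out
  refine Real.le_sqrt_of_sq_le ?_
  rw [mul_pow, Real.sq_sqrt hT.le]
  have : T * c ^ 2 = ∫ _ : AddCircle T, c ^ 2 := by
    simp [Measure.real, AddCircle.measure_univ, hT.le]
  rw [this]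
  refine integral_mono (integrable_const _)
    (integrable_finsetSum _ fun j _ => x.integrable_sq j) fun t => ?_
  refine le_trans ?_ (Finset.single_le_sum (fun j _ => by positivity) (Finset.mem_univ i))
  have := pow_le_pow_left₀ hc (h t) 2
  nlinarith [sq_nonneg ‖x.vel t i‖]

/-- Far away translates in the direction of `u` keep two bodies apart. -/
theorem exists_separation {f : AddCircle T → Space} (hf : Continuous f) (hne : ∀ t, f t ≠ 0)
    (u : Space) : ∃ δ : ℝ, 0 < δ ∧ ∀ᶠ R : ℝ in Filter.atTop, ∀ t, δ ≤ ‖f t + R • u‖ := by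
  by_cases hu : u = 0
  · obtain ⟨t0, -, h0⟩ := isCompact_univ.exists_isMinOn (Set.univ_nonempty (α := AddCircle T))
      hf.norm.continuousOn
    refine ⟨‖f t0‖, norm_pos_iff.2 (hne t0), Filter.Eventually.of_forall fun R t => ?_⟩
    rw [hu, smul_zero, add_zero]
    exact h0 (Set.mem_univ t)
  · obtain ⟨C, hC⟩ := isCompact_univ.exists_bound_of_continuousOn hf.continuousOn
    have hu' : 0 < ‖u‖ := norm_pos_iff.2 hu
    refine ⟨1, one_pos, ?_⟩
    -- With C bounding ‖f‖, a displacement R‖u‖ ≥ C + 1 leaves distance at least 1.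
    filter_upwards [Filter.eventually_ge_atTop ((C + 1) / ‖u‖), Filter.eventually_ge_atTop 0]
      with R hR hR0 t
    have h1 := norm_sub_norm_le (R • u) (-f t)
    rw [norm_smul, Real.norm_of_nonneg hR0, norm_neg, sub_neg_eq_add, add_comm (R • u)] at h1
    have h2 := hC t trivial
    rw [div_le_iff₀ hu'] at hR
    linarith

theorem Loop.kinetic_lt_top (m : Fin n → ℝ) (ω : Space) (x : Loop T n) (i : Fin n) :
    ∫⁻ t, ENNReal.ofReal (m i / 2 * ‖x.vel t i + omegaCross ω (x.pos t i)‖ ^ 2) < ∞ := by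
  have h1 : MemLp (fun t => x.vel t i + omegaCross ω (x.pos t i)) 2 volume := by
    refine (x.memLp_vel_apply i).add ?_
    have hc : Continuous fun t => omegaCross ω (x.pos t i) :=
      (omegaCrossL ω).continuous.comp (x.continuous_pos_apply i)
    exact hc.memLp_of_hasCompactSupport (HasCompactSupport.of_compactSpace _)
  exact ((h1.integrable_norm_pow two_ne_zero).const_mul (m i / 2)).lintegral_lt_top

/-- The key criterion: a collisionless equivariant loop, one of whose bodies stays on one side of a
plane and all of whose bodies stay on the rotation axis, can be pushed to infinity at finite cost. -/
theorem not_isCoercive {m : Fin n → ℝ} {α : ℝ} (hα : 0 < α)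
    {G : Subgroup (FullGroup T n)} {x : Loop T n} (hx : x.IsEquivariant G)
    (hcol : ¬ x.HasCollision) {i : Fin n} {v : Space}
    (hv : ∀ t, inner ℝ (x.pos t i) v ≠ (0 : ℝ)) {ω : Space}
    (hω : ∀ t j, omegaCross ω (x.pos t j) = 0) : ¬ IsCoercive m α ω G := by
  intro hco
  have hT : 0 < T := Fact.out
  set u := x.mean with hu
  have hui : 0 < ‖u i‖ := norm_pos_iff.2 (Loop.mean_ne_zero hv)
  have hωu : ∀ j, omegaCross ω (u j) = 0 := fun j => Loop.omegaCross_mean fun t => hω t j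
  have hsep : ∀ j k : Fin n, ∃ δ : ℝ, 0 < δ ∧ (j ≠ k → ∀ᶠ R : ℝ in Filter.atTop, ∀ t,
      δ ≤ ‖(x.pos t j - x.pos t k) + R • (u j - u k)‖) := by
    intro j k
    by_cases hjk : j = k
    · exact ⟨1, one_pos, fun h => absurd hjk h⟩
    · obtain ⟨δ, hδ, h⟩ := exists_separation
        ((x.continuous_pos_apply j).sub (x.continuous_pos_apply k))
        (fun t h => hcol ⟨t, j, k, hjk, sub_eq_zero.1 h⟩) (u j - u k)
      exact ⟨δ, hδ, fun _ => h⟩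
  choose δ hδ hsep using hsep
  have hsep' : ∀ᶠ R : ℝ in Filter.atTop, ∀ j k, j ≠ k → ∀ t,
      δ j k ≤ ‖(x.pos t j - x.pos t k) + R • (u j - u k)‖ := by
    simp only [Filter.eventually_all]
    exact hsep
  set V : ℝ≥0∞ := ∑ j, ∑ k ∈ Finset.Ioi j,
    ENNReal.ofReal (m j * m k) * ENNReal.ofReal (δ j k) ^ (-α) with hV
  have hVtop : V < ∞ := by
    refine ENNReal.sum_lt_top.2 fun j _ => ENNReal.sum_lt_top.2 fun k _ => ?_
    refine ENNReal.mul_lt_top ENNReal.ofReal_lt_top ?_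
    rw [ENNReal.rpow_neg]
    exact ENNReal.inv_lt_top.2 (ENNReal.rpow_pos (ENNReal.ofReal_pos.2 (hδ j k))
      ENNReal.ofReal_ne_top)
  -- B bounds the action of x + R u for all large R: the kinetic part of x itself, plus the
  -- potential evaluated at the minimal separations δ.
  set B : ℝ≥0∞ := (∫⁻ t, ∑ j, ENNReal.ofReal
    (m j / 2 * ‖x.vel t j + omegaCross ω (x.pos t j)‖ ^ 2)) + ∫⁻ _ : AddCircle T, V with hB
  have hBtop : B < ∞ := by
    refine ENNReal.add_lt_top.2 ⟨?_, ?_⟩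
    · rw [lintegral_finsetSum']
      · exact ENNReal.sum_lt_top.2 fun j _ => x.kinetic_lt_top m ω j
      · intro j _
        have h1 : AEStronglyMeasurable
            (fun t => x.vel t j + omegaCross ω (x.pos t j)) volume :=
          (x.memLp_vel_apply j).aestronglyMeasurable.add
            ((omegaCrossL ω).continuous.comp (x.continuous_pos_apply j)).aestronglyMeasurable
        exact ((h1.norm.aemeasurable.pow_const 2).const_mul _).ennreal_ofReal
    · rw [lintegral_const]
      exact ENNReal.mul_lt_top hVtop (measure_lt_top _ _)
  obtain ⟨R₀, hR₀⟩ := hco (B.toNNReal + 1)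
  obtain ⟨C, hC⟩ := x.exists_bound i
  have hC0 : 0 ≤ C := (norm_nonneg _).trans (hC 0)
  obtain ⟨R, hR, hR1, hR2⟩ := (hsep'.and ((Filter.eventually_ge_atTop
    ((|R₀| / Real.sqrt T + C) / ‖u i‖)).and (Filter.eventually_ge_atTop 0))).exists
  set y := x.translate (fun j => R • u j) with hy
  have hy_eq : y.IsEquivariant G := by
    intro g hg t j
    simp only [hy, Loop.translate, Pi.add_apply, hx g hg t j, hu, Loop.mean_equivariant hx hg,
      spaceAct_add, spaceAct_smul]
  have hnorm : R₀ ≤ y.h1Norm := by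
    have hs : 0 < Real.sqrt T := Real.sqrt_pos.2 hT
    refine le_trans ?_ (Loop.le_h1Norm (i := i) (c := |R₀| / Real.sqrt T) (by positivity) ?_)
    · rw [mul_div_cancel₀ _ hs.ne']; exact le_abs_self _
    · intro t
      rw [div_le_iff₀ hui] at hR1
      have h1 := norm_sub_norm_le (R • u i) (-x.pos t i)
      rw [norm_smul, Real.norm_of_nonneg hR2, norm_neg, sub_neg_eq_add, add_comm (R • u i)] at h1
      have h2 := hC t
      change _ ≤ ‖x.pos t i + R • u i‖
      linarith
  have hle : y.action m α ω ≤ B := by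
    rw [hB, ← lintegral_add_right _ measurable_const]
    refine lintegral_mono fun t => add_le_add (le_of_eq ?_) ?_
    · refine Finset.sum_congr rfl fun j _ => ?_
      change ENNReal.ofReal (m j / 2 * ‖x.vel t j + omegaCross ω (x.pos t j + R • u j)‖ ^ 2) = _
      rw [omegaCross_add_right, omegaCross_smul_right, hωu, smul_zero, add_zero]
    · refine Finset.sum_le_sum fun j _ => Finset.sum_le_sum fun k hk => ?_
      refine mul_le_mul_right ?_ _
      rw [ENNReal.rpow_neg, ENNReal.rpow_neg]
      refine ENNReal.inv_le_inv.2 (ENNReal.rpow_le_rpow (ENNReal.ofReal_le_ofReal ?_) hα.le)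
      refine (hR j k (Finset.mem_Ioi.1 hk).ne t).trans (le_of_eq ?_)
      change _ = ‖(x.pos t j + R • u j) - (x.pos t k + R • u k)‖
      congr 1
      rw [smul_sub]; abel
  have := (hR₀ y hy_eq hnorm).trans hle
  rw [ENNReal.coe_add, ENNReal.coe_toNNReal hBtop.ne] at this
  exact absurd this (not_le.2 (ENNReal.lt_add_right hBtop.ne (by simp)))

end Loops

/-! ### Rotation axes -/

/-- The orthogonal maps that multiply `v` by their determinant. -/
noncomputable def axialGroup (v : Space) : Subgroup O3 where
  carrier := {A | spaceAct A v = spaceDet A • v}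
  one_mem' := by simp [spaceAct_one, spaceDet_one]
  mul_mem' := fun {A B} hA hB => by
    simp only [Set.mem_ofPred_eq] at *
    rw [spaceAct_mul, hB, spaceAct_smul, hA, spaceDet_mul, smul_smul, mul_comm]
  inv_mem' := fun {A} hA => by
    simp only [Set.mem_ofPred_eq] at *
    have h := spaceAct_inv_act A v
    rw [hA, spaceAct_smul] at h
    rw [spaceDet_inv]
    rcases spaceDet_eq A with hd | hd <;> rw [hd] at h ⊢
    · simpa using h
    · have h' : -spaceAct A⁻¹ v = v := by simpa using h
      rw [neg_smul, one_smul, ← h', neg_neg, h']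

theorem mem_axialGroup {A : O3} {v : Space} : A ∈ axialGroup v ↔ spaceAct A v = spaceDet A • v :=
  Iff.rfl

theorem mem_axialGroup_smul {A : O3} {v : Space} (h : A ∈ axialGroup v) (c : ℝ) :
    A ∈ axialGroup (c • v) := by
  rw [mem_axialGroup] at *
  rw [spaceAct_smul, h, smul_comm]

theorem conj_mem_axialGroup {A : O3} {v : Space} (a : O3) :
    a * A * a⁻¹ ∈ axialGroup (spaceAct a v) ↔ A ∈ axialGroup v := by
  rw [mem_axialGroup, mem_axialGroup, spaceAct_mul, spaceAct_mul, spaceAct_inv_act, spaceDet_conj,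
    ← spaceAct_smul]
  exact ⟨fun h => by rw [← spaceAct_inv_act a (spaceAct A v), h, spaceAct_inv_act],
    fun h => by rw [h]⟩

theorem coe_neg_O3 (A : O3) : (-A).1 = -A.1 := rfl

theorem spaceDet_neg (A : O3) : spaceDet (-A) = -spaceDet A := by
  rw [spaceDet, coe_neg_O3, Matrix.det_neg, spaceDet]; norm_num

theorem spaceAct_neg_left (A : O3) (v : Space) : spaceAct (-A) v = -spaceAct A v := by
  simp [spaceAct, coe_neg_O3, Matrix.neg_mulVec]

theorem spaceDet_zeta (p : ℕ) : spaceDet (zeta p) = 1 := by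
  have := Real.cos_sq_add_sin_sq (2 * Real.pi / p)
  simp [spaceDet, zeta, Matrix.det_fin_three]; linarith

theorem spaceDet_kappa : spaceDet kappa = 1 := by
  simp [spaceDet, kappa, Matrix.det_fin_three]

/-- The third coordinate vector. -/
noncomputable def e₃ : Space := !₂[0, 0, 1]

theorem e₃_ne_zero : e₃ ≠ 0 := fun h => by
  simpa [e₃] using congrArg (fun v : Space => v 2) h

theorem spaceAct_zeta_e₃ (p : ℕ) : spaceAct (zeta p) e₃ = e₃ := by
  apply space_ext <;> simp [spaceAct_apply, zeta, e₃]

/-- In odd dimension -1 has determinant -1, so the axial condition does not see signs. -/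
theorem neg_mem_axialGroup {A : O3} {v : Space} (h : A ∈ axialGroup v) : -A ∈ axialGroup v := by
  rw [mem_axialGroup] at *
  rw [spaceAct_neg_left, spaceDet_neg, h, neg_smul]

theorem zeta_mem_axialGroup (p : ℕ) : zeta p ∈ axialGroup e₃ := by
  rw [mem_axialGroup, spaceAct_zeta_e₃, spaceDet_zeta, one_smul]

theorem groupCph_le_axialGroup (p : ℕ) : groupCph p ≤ axialGroup e₃ := by
  unfold groupCph
  split_ifs
  · rw [Subgroup.closure_le]
    rintro A (rfl | rfl)
    · exact neg_mem_axialGroup (one_mem _)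
    · exact zeta_mem_axialGroup p
  · rw [Subgroup.closure_le]
    rintro A rfl
    exact neg_mem_axialGroup (zeta_mem_axialGroup _)

theorem eq_zero_of_kappa {u : Space} (h : kappa ∈ axialGroup u) : u 1 = 0 ∧ u 2 = 0 := by
  rw [mem_axialGroup, spaceDet_kappa, one_smul] at h
  have h1 := congrArg (fun v : Space => v 1) h
  have h2 := congrArg (fun v : Space => v 2) h
  simp [spaceAct_apply, kappa] at h1 h2
  constructor <;> linarith

theorem eq_zero_of_zeta {u : Space} {p : ℕ} (hp : 2 ≤ p) (h : zeta p ∈ axialGroup u)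
    (h1 : u 1 = 0) : u 0 = 0 := by
  rw [mem_axialGroup, spaceDet_zeta, one_smul] at h
  have h0 := congrArg (fun v : Space => v 0) h
  simp [spaceAct_apply, zeta, h1] at h0
  refine (mul_left_eq_self₀.1 h0).resolve_left (ne_of_lt ?_)
  have hp' : (2 : ℝ) ≤ p := by exact_mod_cast hp
  have hpos : 0 < 2 * Real.pi / p := by positivity
  have hle : 2 * Real.pi / p ≤ Real.pi := by
    rw [div_le_iff₀ (by linarith)]; nlinarith [Real.pi_pos]
  simpa using Real.cos_lt_cos_of_nonneg_of_le_pi le_rfl hle hpos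

theorem eq_zero_of_kappa_of_zeta {u : Space} {p : ℕ} (hp : 2 ≤ p) (h : zeta p ∈ axialGroup u)
    (h' : kappa ∈ axialGroup u) : u = 0 := by
  obtain ⟨h1, h2⟩ := eq_zero_of_kappa h'
  exact space_ext (eq_zero_of_zeta hp h h1) h1 h2

theorem mem_axialGroup_of_neg {A : O3} {v : Space} (h : -A ∈ axialGroup v) : A ∈ axialGroup v := by
  simpa using neg_mem_axialGroup h

/-! ### Core, isotropy and rotation axes -/

section Groups

variable {T : ℝ} {n : ℕ} {G : Subgroup (FullGroup T n)}

theorem mem_core {g : FullGroup T n} : g ∈ core G ↔ g ∈ G ∧ tau g = 1 := Iff.rfl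

theorem mem_isotropy {g : FullGroup T n} {i : Fin n} :
    g ∈ isotropy G i ↔ g ∈ G ∧ sigma g i = i := Iff.rfl

theorem ext_fullGroup {g h : FullGroup T n} (h1 : tau g = tau h) (h2 : rho g = rho h)
    (h3 : sigma g = sigma h) : g = h := Prod.ext h1 (Prod.ext h2 h3)

/-- On the core det τ = 1, so the sign on v must equal det ρ. -/
theorem isRotationAxis_core_iff {v : Space} :
    IsRotationAxis (core G) v ↔ v ≠ 0 ∧ (core G).map rho ≤ axialGroup v := by
  refine and_congr_right fun hv => ?_
  rw [Subgroup.map_le_iff_le_comap]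
  refine forall₂_congr fun g hg => ?_
  rw [(mem_core.1 hg).2, timeDet_one, Subgroup.mem_comap, mem_axialGroup]
  constructor
  · rintro (⟨h1, h2⟩ | ⟨h1, h2⟩)
    · rw [h1, ← h2, one_smul]
    · rw [h1, show spaceDet (rho g) = -1 by linarith, neg_smul, one_smul]
  · intro h
    rcases spaceDet_eq (rho g) with hd | hd <;> rw [hd] at h ⊢
    · left; simpa using h
    · right; simpa using h

theorem IsRotationAxis.core {v : Space} (h : IsRotationAxis G v) : IsRotationAxis (core G) v :=
  ⟨h.1, fun g hg => h.2 g (mem_core.1 hg).1⟩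

theorem IsRotationAxis.rho_mem {v : Space} (h : IsRotationAxis G v) {k : FullGroup T n}
    (hk : k ∈ NBody.core G) : rho k ∈ axialGroup v :=
  (isRotationAxis_core_iff.1 h.core).2 (Subgroup.mem_map_of_mem _ hk)

theorem HasSpaceType.conj_mem {N : Subgroup (FullGroup T n)} {F : Subgroup O3} {a : O3}
    (h : N.map rho = F.map (MulAut.conj a).toMonoidHom) {B : O3} (hB : B ∈ F) :
    a * B * a⁻¹ ∈ N.map rho := by
  rw [h]; exact Subgroup.mem_map_of_mem (MulAut.conj a).toMonoidHom hB

/-- After undoing the conjugation, κ confines an axis to the first coordinate line, which no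
nontrivial rotation about e₃ fixes pointwise. -/
theorem not_isRotationAxis_of_isDihedralType (h : IsDihedralType (core G)) (v : Space) :
    ¬ IsRotationAxis (core G) v := by
  rw [isRotationAxis_core_iff]
  rintro ⟨hv, hle⟩
  have key : ∀ (F : Subgroup O3) (a : O3), (core G).map rho = F.map (MulAut.conj a).toMonoidHom →
      F ≤ axialGroup (spaceAct a⁻¹ v) := by
    intro F a ha B hB
    have := hle (HasSpaceType.conj_mem ha hB)
    rw [← spaceAct_act_inv a v] at this
    exact (conj_mem_axialGroup a).1 this
  rcases h with ⟨p, hp, -, a, ha⟩ | ⟨p, hp, a, ha⟩ | ⟨p, hp, a, ha⟩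
  · have := key _ a ha
    refine spaceAct_ne_zero a⁻¹ hv (eq_zero_of_kappa_of_zeta hp (this ?_) (this ?_)) <;>
      exact Subgroup.subset_closure (by simp)
  · have := key _ a ha
    refine spaceAct_ne_zero a⁻¹ hv (eq_zero_of_kappa_of_zeta hp (this ?_)
      (mem_axialGroup_of_neg (this ?_))) <;>
      exact Subgroup.subset_closure (by simp)
  · have := key _ a ha
    -- Here p = 1 is allowed and ζ_1 is trivial, so the rotation is taken from -ζ_{2p}.
    refine spaceAct_ne_zero a⁻¹ hv (eq_zero_of_kappa_of_zeta (p := 2 * p) (by omega)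
      (mem_axialGroup_of_neg (this ?_)) (this ?_)) <;>
      exact Subgroup.subset_closure (by simp)

/-- Both w and v are negated by A, whose determinant is -1, so A negates w × v; but A fixes every
vector orthogonal to w. -/
theorem IsReflectionAlong.exists_smul_of_axial {A : O3} {w v : Space} (h : IsReflectionAlong A w)
    (hv : A ∈ axialGroup v) : ∃ c : ℝ, v = c • w := by
  rw [mem_axialGroup, h.spaceDet_eq, neg_smul, one_smul] at hv
  by_cases h0 : v = 0
  · exact ⟨0, by simp [h0]⟩
  refine eq_smul_of_omegaCross_eq_zero h.1 ?_
  have := omegaCross_spaceAct A w v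
  rw [h.2.1, hv, h.2.2 _ (inner_omegaCross_left w v), h.spaceDet_eq, ← neg_one_smul ℝ w,
    ← neg_one_smul ℝ v, omegaCross_smul_left, omegaCross_smul_right, smul_smul] at this
  simp only [neg_mul_neg, one_mul, one_smul, neg_smul] at this
  exact eq_zero_of_eq_neg_self this

/-- In the prism case, the axis is orthogonal to the plane of any reflection. -/
theorem isRotationAxis_of_isTypeCph (h : IsTypeCph (core G)) {s : FullGroup T n}
    (hs : s ∈ core G) {w : Space} (hw : IsReflectionAlong (rho s) w) {c : ℝ} (hc : c ≠ 0) :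
    IsRotationAxis (core G) (c • w) := by
  obtain ⟨p, -, a, ha⟩ := h
  have hle : (core G).map rho ≤ axialGroup (spaceAct a e₃) := by
    rw [ha]
    rintro _ ⟨B, hB, rfl⟩
    exact (conj_mem_axialGroup a).2 (groupCph_le_axialGroup p hB)
  obtain ⟨d, hd⟩ := hw.exists_smul_of_axial (hle (Subgroup.mem_map_of_mem rho hs))
  have hd0 : d ≠ 0 := fun h0 => spaceAct_ne_zero a e₃_ne_zero (by rw [hd, h0, zero_smul])
  refine isRotationAxis_core_iff.2 ⟨smul_ne_zero hc hw.1, fun A hA => ?_⟩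
  have := mem_axialGroup_smul (hle hA) (c * d⁻¹)
  rwa [hd, smul_smul, mul_assoc, inv_mul_cancel₀ hd0, mul_one] at this

theorem rho_eq_of_mem_zpowers {s k : FullGroup T n} (hs : rho s * rho s = 1)
    (hk : k ∈ Subgroup.zpowers s) : rho k = 1 ∨ rho k = rho s := by
  obtain ⟨j, rfl⟩ := Subgroup.mem_zpowers_iff.1 hk
  rw [map_zpow]
  rcases Int.even_or_odd' j with ⟨l, rfl | rfl⟩
  · left; rw [zpow_mul, zpow_two, hs, one_zpow]
  · right; rw [zpow_add, zpow_mul, zpow_two, hs, one_zpow, one_mul, zpow_one]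

/-- A group acting faithfully by one and the same reflection is generated by it. -/
theorem generatedByReflection_of_forall {N : Subgroup (FullGroup T n)} {w : Space}
    (hinj : ∀ g ∈ N, rho g = 1 → g = 1) (hN : N ≠ ⊥)
    (h : ∀ g ∈ N, rho g = 1 ∨ IsReflectionAlong (rho g) w) :
    GeneratedByReflection N (ℝ ∙ w)ᗮ := by
  obtain ⟨s, hs, hs1⟩ := N.bot_or_exists_ne_one.resolve_left hN
  have hsw := (h s hs).resolve_left fun h => hs1 (hinj s hs h)
  refine ⟨s, isPlaneReflection_iff.2 ⟨w, rfl, hsw⟩, le_antisymm (fun g hg => ?_)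
    ((Subgroup.zpowers_le).2 hs)⟩
  rcases h g hg with h1 | h1
  · rw [hinj g hg h1]; exact one_mem _
  · have : g * s⁻¹ = 1 := hinj _ (mul_mem hg (inv_mem hs)) (by
      rw [map_mul, map_inv, h1.eq hsw, mul_inv_cancel])
    rw [mul_inv_eq_one.1 this]; exact Subgroup.mem_zpowers s

theorem GeneratedByReflection.ne_bot {N : Subgroup (FullGroup T n)} {P : Submodule ℝ Space}
    (h : GeneratedByReflection N P) : N ≠ ⊥ := by
  obtain ⟨s, hs, rfl⟩ := h
  obtain ⟨w, -, hw⟩ := isPlaneReflection_iff.1 hs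
  intro h
  rw [Subgroup.zpowers_eq_bot] at h
  exact hw.ne_one (by rw [h, map_one])

/-- An orthogonal map preserving the normal line preserves the plane. -/
theorem exists_omegaCross_ne_zero {w : Space} (h : ¬ LeavesInvariant (core G) (ℝ ∙ w)ᗮ) :
    ∃ k ∈ core G, omegaCross w (spaceAct (rho k) w) ≠ 0 := by
  by_contra hc
  push Not at hc
  refine h fun k hk v hv => ?_
  by_cases hw : w = 0
  · simp [hw]
  rw [Submodule.mem_orthogonal_singleton_iff_inner_right] at hv ⊢
  obtain ⟨c, hc⟩ := eq_smul_of_omegaCross_eq_zero hw (hc k hk)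
  have h1 := spaceAct_inner (rho k) w v
  rw [hc, real_inner_smul_left, hv] at h1
  exact (mul_eq_zero.1 h1).resolve_left fun h0 =>
    spaceAct_ne_zero (rho k) hw (by rw [hc, h0, zero_smul])

theorem omegaCross_eq_zero_of_leavesInvariant {w : Space}
    (h : LeavesInvariant (core G) (ℝ ∙ w)ᗮ) {k : FullGroup T n} (hk : k ∈ core G) :
    omegaCross w (spaceAct (rho k) w) = 0 := by
  by_cases hw : w = 0
  · rw [hw, omegaCross_zero_left]
  have hww : (inner ℝ w w : ℝ) ≠ 0 := inner_self_ne_zero.2 hw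
  set y := spaceAct (rho k) w with hy
  set c : ℝ := inner ℝ w y / inner ℝ w w with hcdef
  have h0 : inner ℝ w (y - c • w) = (0 : ℝ) := by
    rw [inner_sub_right, real_inner_smul_right, hcdef]; field_simp; ring
  -- The component of y = ρ(k)w orthogonal to w lies in the plane. Pulled back by k it stays there,
  -- so it is also orthogonal to y, hence to itself.
  have h1 := h k⁻¹ (inv_mem hk) _ (Submodule.mem_orthogonal_singleton_iff_inner_right.2 h0)
  rw [Submodule.mem_orthogonal_singleton_iff_inner_right, map_inv, ← spaceAct_inner (rho k),
    spaceAct_act_inv, ← hy] at h1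
  have h2 : inner ℝ (y - c • w) (y - c • w) = (0 : ℝ) := by
    nth_rewrite 1 [inner_sub_left]
    rw [real_inner_smul_left, h0, h1]; ring
  rw [sub_eq_zero.1 (inner_self_eq_zero.1 h2), omegaCross_smul_right, omegaCross_self, smul_zero]

end Groups

section Loops

variable {T : ℝ} [Fact (0 < T)] {n : ℕ} {G : Subgroup (FullGroup T n)} {x : Loop T n}

/-! ### Collisionless equivariant loops -/

theorem Loop.IsEquivariant.core (hx : x.IsEquivariant G) {k : FullGroup T n}
    (hk : k ∈ NBody.core G) (t : AddCircle T) (i : Fin n) :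
    x.pos t (sigma k i) = spaceAct (rho k) (x.pos t i) := by
  have := hx k (mem_core.1 hk).1 t i
  rwa [(mem_core.1 hk).2] at this

theorem Loop.IsEquivariant.sigma_eq (hx : x.IsEquivariant G) (hcol : ¬ x.HasCollision)
    {k : FullGroup T n} (hk : k ∈ NBody.core G) {t : AddCircle T} {i : Fin n}
    (h : spaceAct (rho k) (x.pos t i) = x.pos t i) : sigma k i = i := by
  by_contra hne
  exact hcol ⟨t, _, _, hne, (hx.core hk t i).trans h⟩

theorem Loop.IsEquivariant.eq_one (hx : x.IsEquivariant G) (hcol : ¬ x.HasCollision)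
    {k : FullGroup T n} (hk : k ∈ NBody.core G) (h : rho k = 1) : k = 1 := by
  refine ext_fullGroup ((mem_core.1 hk).2) h (Equiv.ext fun i => ?_)
  exact hx.sigma_eq hcol hk (t := 0) (by rw [h, spaceAct_one])

/-- The group maps ω to ±ω, so by transitivity one body on the axis line puts all of them there. -/
theorem Loop.IsEquivariant.omegaCross_eq_zero (hx : x.IsEquivariant G) (htrans : IsTransitive G)
    {ω : Space} (hω : ω = 0 ∨ IsRotationAxis G ω) {i : Fin n}
    (h : ∀ t, omegaCross ω (x.pos t i) = 0) (t : AddCircle T) (j : Fin n) :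
    omegaCross ω (x.pos t j) = 0 := by
  rcases hω with rfl | hω
  · exact omegaCross_zero_left _
  obtain ⟨g, hg, rfl⟩ := htrans i j
  obtain ⟨t, rfl⟩ := (tau g).surjective t
  rw [hx g hg]
  have h1 := omegaCross_spaceAct (rho g) ω (x.pos t i)
  rw [h t, spaceAct_zero, smul_zero] at h1
  rcases hω.2 g hg with ⟨h2, -⟩ | ⟨h2, -⟩ <;> rw [h2] at h1
  · exact h1
  · rw [← neg_one_smul ℝ ω, omegaCross_smul_left] at h1
    exact (smul_eq_zero.1 h1).resolve_left (by norm_num)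

/-- The trichotomy for the maximal isotropy groups of the core. -/
theorem trichotomy {m : Fin n → ℝ} {α : ℝ} (hα : 0 < α) (htrans : IsTransitive G) (i : Fin n)
    (hbound : ¬ BoundToCollision G) (hunc : ¬ FullyUncoercive m α G) :
    core G ⊓ isotropy G i = ⊥ ∨ (∃ P, GeneratedByReflection (core G ⊓ isotropy G i) P) ∨
      core G ⊓ isotropy G i = core G := by
  simp only [BoundToCollision, FullyUncoercive, not_forall, not_not] at hbound hunc
  obtain ⟨x, hx, hcol⟩ := hbound
  obtain ⟨ω, hω, hco⟩ := hunc
  by_cases hbot : core G ⊓ isotropy G i = ⊥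
  · exact Or.inl hbot
  by_cases htop : core G ⊓ isotropy G i = core G
  · exact Or.inr (Or.inr htop)
  refine Or.inr (Or.inl ?_)
  have hinj : ∀ g ∈ core G ⊓ isotropy G i, rho g = 1 → g = 1 := fun g hg =>
    hx.eq_one hcol hg.1
  have hfix : ∀ g ∈ core G ⊓ isotropy G i, ∀ t, spaceAct (rho g) (x.pos t i) = x.pos t i := by
    intro g hg t
    rw [← hx.core hg.1, (mem_isotropy.1 hg.2).2]
  -- A body at the origin is fixed by all of K, so its index would be too.
  have hne : ∀ t, x.pos t i ≠ 0 := by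
    intro t ht
    refine htop (le_antisymm inf_le_left fun k hk => ⟨hk, (mem_core.1 hk).1, ?_⟩)
    exact hx.sigma_eq hcol hk (t := t) (by rw [ht, spaceAct_zero])
  by_cases hline : ∀ t, omegaCross (x.pos 0 i) (x.pos t i) = 0
  · by_cases hωe : omegaCross (x.pos 0 i) ω = 0
    · exfalso
      -- On a line through the origin, never vanishing means staying on one side.
      refine not_isCoercive hα hx hcol (i := i) (v := x.pos 0 i) (fun t h0 => ?_)
        (hx.omegaCross_eq_zero htrans hω (i := i) fun t => ?_) hco
      · exact omegaCross_ne_zero_of_orthogonal (hne 0) (hne t) (by rwa [real_inner_comm]) (hline t)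
      · obtain ⟨c, hc⟩ := eq_smul_of_omegaCross_eq_zero (hne 0) (hline t)
        rw [hc, omegaCross_smul_right, omegaCross_anticomm, hωe, neg_zero, smul_zero]
    · have hω' : IsRotationAxis G ω := hω.resolve_left fun h => hωe (by
        rw [h, omegaCross_anticomm, omegaCross_zero_left, neg_zero])
      refine ⟨_, generatedByReflection_of_forall (w := ω) hinj hbot fun g hg => ?_⟩
      have h1 := hω'.rho_mem hg.1
      -- The vectors x_i(0) and ω are independent. Determinant 1 fixes both, giving the identity;
      -- determinant -1 gives a reflection that negates ω.
      rw [mem_axialGroup] at h1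
      rcases spaceDet_eq (rho g) with hd | hd
      · left
        rw [hd, one_smul] at h1
        refine (eq_one_or_isReflectionAlong hωe (hfix g hg 0) h1).resolve_right fun h => ?_
        rw [h.spaceDet_eq] at hd; norm_num at hd
      · right
        obtain ⟨w, -, hw⟩ := exists_isReflectionAlong (hne 0) (hfix g hg 0) hd
        obtain ⟨c, hc⟩ := hw.exists_smul_of_axial (hω'.rho_mem hg.1)
        rw [hc]
        exact hw.smul fun h0 => hω'.1 (by rw [hc, h0, zero_smul])
  · push Not at hline
    obtain ⟨t, ht⟩ := hline
    exact ⟨_, generatedByReflection_of_forall hinj hbot fun g hg =>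
      eq_one_or_isReflectionAlong ht (hfix g hg 0) (hfix g hg t)⟩

/-- Two reflections along different planes in the core, one of which generates the isotropy. -/
theorem fullyUncoercive_of_reflections {m : Fin n → ℝ} {α : ℝ} (hα : 0 < α)
    (hx : x.IsEquivariant G) (hcol : ¬ x.HasCollision) {i : Fin n} {s k : FullGroup T n}
    {w w' : Space} (hs : core G ⊓ isotropy G i = Subgroup.zpowers s)
    (hw : IsReflectionAlong (rho s) w) (hk : k ∈ core G) (hw' : IsReflectionAlong (rho k) w')
    (hww : omegaCross w w' ≠ 0) : FullyUncoercive m α G := by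
  have hsc : s ∈ core G := (hs ▸ Subgroup.mem_zpowers s : s ∈ core G ⊓ isotropy G i).1
  rintro ω (rfl | hω)
  · refine not_isCoercive hα hx hcol (i := i) (v := w') (fun t ht => ?_)
      fun _ _ => omegaCross_zero_left _
    -- Body i on the mirror plane of k would put k in the isotropy, which contains no reflection
    -- other than ρ(s).
    have h1 : k ∈ core G ⊓ isotropy G i := ⟨hk, (mem_core.1 hk).1,
      hx.sigma_eq hcol hk (hw'.2.2 _ (by rwa [real_inner_comm]))⟩
    rw [hs] at h1
    rcases rho_eq_of_mem_zpowers hw.mul_self h1 with h2 | h2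
    · exact hw'.ne_one h2
    · rw [h2] at hw'
      obtain ⟨c, -, rfl⟩ := hw.exists_smul hw'
      exact hww (by rw [omegaCross_smul_right, omegaCross_self, smul_zero])
  · exfalso
    obtain ⟨c, hc⟩ := hw.exists_smul_of_axial (hω.rho_mem hsc)
    obtain ⟨d, hd⟩ := hw'.exists_smul_of_axial (hω.rho_mem hk)
    have hd0 : d ≠ 0 := fun h0 => hω.1 (by rw [hd, h0, zero_smul])
    have hwd : w' = (d⁻¹ * c) • w := by
      rw [mul_smul, ← hc, hd, inv_smul_smul₀ hd0]
    exact hww (by rw [hwd, omegaCross_smul_right, omegaCross_self, smul_zero])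

/-- The conjugate k s k⁻¹ is the second reflection, with normal ρ(k)w. -/
theorem fullyUncoercive_of_omegaCross_ne_zero {m : Fin n → ℝ} {α : ℝ} (hα : 0 < α)
    (hx : x.IsEquivariant G) (hcol : ¬ x.HasCollision) {i : Fin n} {s k : FullGroup T n}
    {w : Space} (hs : core G ⊓ isotropy G i = Subgroup.zpowers s)
    (hw : IsReflectionAlong (rho s) w) (hk : k ∈ core G)
    (hwk : omegaCross w (spaceAct (rho k) w) ≠ 0) : FullyUncoercive m α G := by
  have hsc : s ∈ core G := (hs ▸ Subgroup.mem_zpowers s : s ∈ core G ⊓ isotropy G i).1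
  refine fullyUncoercive_of_reflections hα hx hcol hs hw (k := k * s * k⁻¹)
    (mul_mem (mul_mem hk hsc) (inv_mem hk)) ?_ hwk
  rw [map_mul, map_mul, map_inv]
  exact hw.conj _

/-- If the line of w is invariant, some k acts on w by the sign opposite to det ρ(k). Then k or k s
fixes w and has determinant -1: a reflection whose normal is orthogonal to w. -/
theorem fullyUncoercive_of_not_isRotationAxis {m : Fin n → ℝ} {α : ℝ} (hα : 0 < α)
    (hx : x.IsEquivariant G) (hcol : ¬ x.HasCollision) {i : Fin n} {s : FullGroup T n}
    {w : Space} (hs : core G ⊓ isotropy G i = Subgroup.zpowers s)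
    (hw : IsReflectionAlong (rho s) w) (hax : ¬ IsRotationAxis (core G) w) :
    FullyUncoercive m α G := by
  have hsc : s ∈ core G := (hs ▸ Subgroup.mem_zpowers s : s ∈ core G ⊓ isotropy G i).1
  by_cases h : ∃ k ∈ core G, omegaCross w (spaceAct (rho k) w) ≠ 0
  · obtain ⟨k, hk, hwk⟩ := h
    exact fullyUncoercive_of_omegaCross_ne_zero hα hx hcol hs hw hk hwk
  push Not at h
  have hrefl : ∀ k ∈ core G, spaceAct (rho k) w = w → spaceDet (rho k) = -1 →
      FullyUncoercive m α G := by
    intro k hk h1 h2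
    obtain ⟨w', hww, hw'⟩ := exists_isReflectionAlong hw.1 h1 h2
    exact fullyUncoercive_of_reflections hα hx hcol hs hw hk hw'
      (omegaCross_ne_zero_of_orthogonal hw.1 hw'.1 hww)
  rw [isRotationAxis_core_iff] at hax
  push Not at hax
  obtain ⟨_, ⟨k, hk, rfl⟩, hkw⟩ := Set.not_subset.1 (hax hw.1)
  obtain ⟨c, hc⟩ := eq_smul_of_omegaCross_eq_zero hw.1 (h k hk)
  have hc1 : c = 1 ∨ c = -1 := by
    have := spaceAct_norm (rho k) w
    rw [hc, norm_smul, Real.norm_eq_abs] at this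
    have h1 : |c| = 1 := mul_right_cancel₀ (norm_ne_zero_iff.2 hw.1) (this.trans (one_mul _).symm)
    exact (abs_eq zero_le_one).1 h1
  have hcd : c ≠ spaceDet (rho k) := fun h => hkw (by
    rw [SetLike.mem_coe, mem_axialGroup, hc, h])
  rcases hc1 with rfl | rfl
  · exact hrefl k hk (by rw [hc, one_smul]) ((spaceDet_eq _).resolve_left (Ne.symm hcd))
  · refine hrefl (k * s) (mul_mem hk hsc) ?_ ?_
    · rw [map_mul, spaceAct_mul, hw.2.1, spaceAct_neg, hc, neg_smul, one_smul, neg_neg]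
    · rw [map_mul, spaceDet_mul, hw.spaceDet_eq, (spaceDet_eq _).resolve_right (Ne.symm hcd),
        one_mul]

end Loops

/-! ### Finite subgroups of `O(3)` with an invariant line -/

theorem O3_ext_entries {A B : O3} (h : ∀ i j, A.1 i j = B.1 i j) : A = B :=
  Subtype.ext (Matrix.ext h)

/-- The rotations about the third axis. -/
noncomputable def rotZ : Circle →* O3 where
  toFun z := ⟨!![(z : ℂ).re, -(z : ℂ).im, 0; (z : ℂ).im, (z : ℂ).re, 0; 0, 0, 1], by
    rw [Matrix.mem_orthogonalGroup_iff]
    have h : (z : ℂ).re * (z : ℂ).re + (z : ℂ).im * (z : ℂ).im = 1 := by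
      rw [← Complex.normSq_apply]; exact Circle.normSq_coe z
    ext i j
    fin_cases i <;> fin_cases j <;>
      simp [Matrix.mul_apply, Fin.sum_univ_three] <;> linarith⟩
  map_one' := O3_ext_entries fun i j => by
    fin_cases i <;> fin_cases j <;> simp
  map_mul' z w := O3_ext_entries fun i j => by
    fin_cases i <;> fin_cases j <;>
      simp <;> ring

theorem zeta_eq_rotZ (p : ℕ) : zeta p = rotZ (Circle.exp (2 * Real.pi / p)) := by
  refine O3_ext_entries fun i j => ?_
  have h : ((Circle.exp (2 * Real.pi / p) : Circle) : ℂ) =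
      Complex.exp ((2 * Real.pi / p : ℝ) * Complex.I) := Circle.coe_exp _
  have h1 : ((Circle.exp (2 * Real.pi / p) : Circle) : ℂ).re = Real.cos (2 * Real.pi / p) := by
    rw [h, Complex.exp_ofReal_mul_I_re]
  have h2 : ((Circle.exp (2 * Real.pi / p) : Circle) : ℂ).im = Real.sin (2 * Real.pi / p) := by
    rw [h, Complex.exp_ofReal_mul_I_im]
  clear h
  generalize Circle.exp (2 * Real.pi / p) = z at *
  fin_cases i <;> fin_cases j <;> simp [zeta, rotZ, h1, h2]

theorem rotZ_injective : Function.Injective rotZ := by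
  intro z w h
  have h0 := congrArg (fun A : O3 => A.1 0 0) h
  have h1 := congrArg (fun A : O3 => A.1 1 0) h
  simp [rotZ] at h0 h1
  exact Circle.ext (Complex.ext h0 h1)

theorem circleExp_pow (θ : ℝ) (k : ℕ) : Circle.exp θ ^ k = Circle.exp (k * θ) := by
  induction k with
  | zero => simp
  | succ k ih => rw [pow_succ, ih, ← Circle.exp_add]; congr 1; push_cast; ring

theorem zeta_mul_pow (a : ℕ) {q : ℕ} (hq : q ≠ 0) : zeta (a * q) ^ q = zeta a := by
  rw [zeta_eq_rotZ, zeta_eq_rotZ, ← map_pow, circleExp_pow]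
  congr 2
  have : (q : ℝ) ≠ 0 := by exact_mod_cast hq
  push_cast
  by_cases ha : (a : ℝ) = 0
  · simp [ha]
  · field_simp

/-- The reflection along the horizontal plane. -/
noncomputable def mirror : O3 := -zeta 2

theorem zeta_one : zeta 1 = 1 := by
  rw [zeta_eq_rotZ]; simp

theorem zeta_two_mul_self : zeta 2 * zeta 2 = 1 := by
  rw [← pow_two, ← zeta_one, ← zeta_mul_pow 1 two_ne_zero]

theorem mirror_mul_self : mirror * mirror = 1 := by
  rw [mirror, neg_mul_neg, zeta_two_mul_self]

theorem mirror_mul_zeta_two : mirror * zeta 2 = -1 := by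
  rw [mirror, neg_mul, zeta_two_mul_self]

theorem mirror_mul_rotZ (z : Circle) : mirror * rotZ z = rotZ z * mirror := by
  rw [mirror, zeta_eq_rotZ, neg_mul, mul_neg, ← map_mul, ← map_mul, mul_comm]

theorem spaceDet_mirror : spaceDet mirror = -1 := by
  rw [mirror, spaceDet_neg, spaceDet_zeta]

theorem spaceAct_mirror_e₃ : spaceAct mirror e₃ = -e₃ := by
  rw [mirror, spaceAct_neg_left, spaceAct_zeta_e₃]

theorem isReflectionAlong_mirror : IsReflectionAlong mirror e₃ := by
  refine ⟨e₃_ne_zero, spaceAct_mirror_e₃, fun v hv => ?_⟩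
  have hv2 : v 2 = 0 := by simpa [inner_eq, e₃] using hv
  have : (2 : ℝ) * Real.pi / 2 = Real.pi := by ring
  apply space_ext <;> simp [mirror, spaceAct_apply, coe_neg_O3, zeta, hv2, this]

theorem kappa_mul_self : kappa * kappa = 1 := by
  refine O3_ext_entries fun i j => ?_
  fin_cases i <;> fin_cases j <;> simp [kappa]

theorem spaceAct_kappa_e₃ : spaceAct kappa e₃ = -e₃ := by
  apply space_ext <;> simp [spaceAct_apply, kappa, e₃]

theorem kappa_mul_rotZ (z : Circle) : kappa * rotZ z = rotZ z⁻¹ * kappa := by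
  refine O3_ext_entries fun i j => ?_
  fin_cases i <;> fin_cases j <;>
    simp [kappa, rotZ]

/-- Fixing e₃ determines the last column, orthogonality the last row, and the remaining block is a
plane rotation. -/
theorem exists_eq_rotZ {A : O3} (h : spaceAct A e₃ = e₃) (hd : spaceDet A = 1) :
    ∃ z, A = rotZ z := by
  have c0 : A.1 0 2 = 0 := by simpa [spaceAct_apply, e₃] using congrArg (fun v : Space => v 0) h
  have c1 : A.1 1 2 = 0 := by simpa [spaceAct_apply, e₃] using congrArg (fun v : Space => v 1) h
  have c2 : A.1 2 2 = 1 := by simpa [spaceAct_apply, e₃] using congrArg (fun v : Space => v 2) h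
  have e : ∀ i j, A.1 0 i * A.1 0 j + A.1 1 i * A.1 1 j + A.1 2 i * A.1 2 j =
      (1 : Matrix (Fin 3) (Fin 3) ℝ) i j := fun i j => by
    rw [← transpose_mul_self A]; simp [Matrix.mul_apply, Fin.sum_univ_three]
  have r0 : A.1 2 0 = 0 := by have := e 0 2; simpa [c0, c1, c2] using this
  have r1 : A.1 2 1 = 0 := by have := e 1 2; simpa [c0, c1, c2] using this
  have e00 := e 0 0; have e01 := e 0 1; have e11 := e 1 1
  simp [r0, r1] at e00 e01 e11
  simp [spaceDet, Matrix.det_fin_three, c0, c1, c2] at hd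
  have h11 : A.1 1 1 = A.1 0 0 := by
    linear_combination A.1 0 0 * hd - A.1 1 1 * e00 + A.1 1 0 * e01
  have h01 : A.1 0 1 = -A.1 1 0 := by
    linear_combination (-A.1 0 1) * e00 + A.1 0 0 * e01 - A.1 1 0 * hd
  refine ⟨⟨⟨A.1 0 0, A.1 1 0⟩, ?_⟩, O3_ext_entries fun i j => ?_⟩
  · change _ ∈ Metric.sphere _ _
    rw [mem_sphere_zero_iff_norm, ← sq_eq_sq₀ (norm_nonneg _) zero_le_one,
      ← Complex.normSq_eq_norm_sq, Complex.normSq_apply]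
    simpa using e00
  · fin_cases i <;> fin_cases j <;> simp [rotZ, c0, c1, c2, r0, r1, h11, h01]

/-- For even p the half-turn ζ_2 is a power of ζ_p, and mirror · ζ_2 = -1. -/
theorem mirror_mem_iff_of_even {p : ℕ} (hp : Even p) (hp0 : p ≠ 0) (H : Subgroup O3)
    (hz : zeta p ∈ H) : mirror ∈ H ↔ -1 ∈ H := by
  obtain ⟨q, rfl⟩ := hp.two_dvd
  have hq : zeta 2 ∈ H := by
    rw [← zeta_mul_pow 2 (q := q) (by rintro rfl; simp at hp0)]
    exact pow_mem hz q
  constructor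
  · intro h
    rw [← mirror_mul_zeta_two]; exact mul_mem h hq
  · intro h
    rw [mirror, ← neg_one_mul]; exact mul_mem h hq

/-- For odd p the square of -ζ_{2p} is ζ_p and its p-th power is the mirror. Conversely, with p = 2q
+ 1, mirror · ζ_p^(q+1) = -ζ_{2p}. -/
theorem neg_zeta_mem_iff_of_odd {p : ℕ} (hp : Odd p) (H : Subgroup O3) :
    -zeta (2 * p) ∈ H ↔ zeta p ∈ H ∧ mirror ∈ H := by
  have hp0 : p ≠ 0 := by rintro rfl; simp at hp
  have h2 : zeta (2 * p) ^ 2 = zeta p := by rw [mul_comm]; exact zeta_mul_pow p two_ne_zero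
  have hpp : zeta (2 * p) ^ p = zeta 2 := zeta_mul_pow 2 hp0
  constructor
  · intro h
    refine ⟨?_, ?_⟩
    · rw [← h2, ← neg_sq]; exact pow_mem h 2
    · rw [mirror, ← hpp, ← hp.neg_pow]; exact pow_mem h p
  · rintro ⟨h, hm⟩
    obtain ⟨q, hq⟩ := hp
    have : -zeta (2 * p) = mirror * zeta p ^ (q + 1) := by
      rw [← h2, ← pow_mul, show 2 * (q + 1) = p + 1 by omega, pow_succ, hpp, ← mul_assoc,
        mirror_mul_zeta_two, neg_one_mul]
    rw [this]; exact mul_mem hm (pow_mem h _)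

theorem groupCph_le_iff {p : ℕ} (hp : p ≠ 0) (H : Subgroup O3) :
    groupCph p ≤ H ↔ zeta p ∈ H ∧ mirror ∈ H := by
  unfold groupCph
  split_ifs with h
  · rw [Subgroup.closure_le, Set.insert_subset_iff, Set.singleton_subset_iff, SetLike.mem_coe,
      SetLike.mem_coe, and_comm]
    exact and_congr_right fun hz => (mirror_mem_iff_of_even h hp H hz).symm
  · rw [Subgroup.closure_le, Set.singleton_subset_iff, SetLike.mem_coe,
      neg_zeta_mem_iff_of_odd (Nat.not_even_iff_odd.1 h)]

theorem groupIDp_le_iff {p : ℕ} (hp : p ≠ 0) (he : Even p) (H : Subgroup O3) :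
    groupIDp p ≤ H ↔ zeta p ∈ H ∧ mirror ∈ H ∧ kappa ∈ H := by
  rw [groupIDp, Subgroup.closure_le, Set.insert_subset_iff, Set.insert_subset_iff,
    Set.singleton_subset_iff]
  simp only [SetLike.mem_coe]
  constructor
  · rintro ⟨h1, h2, h3⟩
    exact ⟨h2, (mirror_mem_iff_of_even he hp H h2).2 h1, h3⟩
  · rintro ⟨h1, h2, h3⟩
    exact ⟨(mirror_mem_iff_of_even he hp H h1).1 h2, h1, h3⟩

theorem groupD2pDp_le_iff {p : ℕ} (ho : Odd p) (H : Subgroup O3) :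
    groupD2pDp p ≤ H ↔ zeta p ∈ H ∧ mirror ∈ H ∧ kappa ∈ H := by
  rw [groupD2pDp, Subgroup.closure_le, Set.insert_subset_iff, Set.insert_subset_iff,
    Set.singleton_subset_iff]
  simp only [SetLike.mem_coe, neg_zeta_mem_iff_of_odd ho]
  tauto

/-- A finite subgroup of the circle consists of the roots of unity of its order. -/
theorem exists_eq_zpowers_exp (C : Subgroup Circle) [Finite C] :
    ∃ p : ℕ, p ≠ 0 ∧ C = Subgroup.zpowers (Circle.exp (2 * Real.pi / p)) := by
  have hp : Nat.card C ≠ 0 := Nat.card_pos.ne'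
  refine ⟨Nat.card C, hp, ?_⟩
  set p := Nat.card C with hpdef
  set ε := Circle.exp (2 * Real.pi / p) with hε
  have hεprim : IsPrimitiveRoot (ε : ℂ) p := by
    have := Complex.isPrimitiveRoot_exp p hp
    rw [hε, Circle.coe_exp]
    convert this using 2
    push_cast; ring
  have : IsCyclic C := isCyclic_of_injective_ringHom (Circle.coeHom.comp C.subtype)
    (fun a b h => Subtype.ext (Circle.ext h))
  obtain ⟨g, hg⟩ := IsCyclic.exists_generator (α := C)
  have hgo : orderOf g = p := orderOf_eq_card_of_forall_mem_zpowers hg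
  have hgprim : IsPrimitiveRoot ((g : Circle) : ℂ) p := by
    have h1 := IsPrimitiveRoot.orderOf g
    rw [hgo] at h1
    exact h1.map_of_injective (f := Circle.coeHom.comp C.subtype)
      (fun a b h => Subtype.ext (Circle.ext h))
  have : NeZero p := ⟨hp⟩
  refine le_antisymm (fun z hz => ?_) (Subgroup.zpowers_le.2 ?_)
  · have h1 : (⟨z, hz⟩ : C) ^ p = 1 := pow_card_eq_one'
    have h2 : (z : ℂ) ^ p = 1 := by
      have := congrArg (fun c : C => ((c : Circle) : ℂ)) h1
      simpa using this
    obtain ⟨i, -, hi⟩ := hεprim.eq_pow_of_pow_eq_one h2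
    have : ε ^ i = z := Circle.ext (by rw [Circle.coe_pow, hi])
    rw [← this]; exact Subgroup.npow_mem_zpowers ε i
  · obtain ⟨i, -, hi⟩ := hgprim.eq_pow_of_pow_eq_one hεprim.pow_eq_one
    have : (g : Circle) ^ i = ε := Circle.ext (by rw [Circle.coe_pow, hi])
    rw [← this]; exact pow_mem g.2 i

/-! ### Finite groups containing the horizontal mirror -/

section Classification

variable {M : Subgroup O3}

theorem exists_rotations_eq (hfin : (M : Set O3).Finite) :
    ∃ p : ℕ, p ≠ 0 ∧ zeta p ∈ M ∧ ∀ A ∈ M, spaceAct A e₃ = e₃ → spaceDet A = 1 →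
      A ∈ Subgroup.zpowers (zeta p) := by
  have : Finite (M.comap rotZ) := (hfin.preimage rotZ_injective.injOn).to_subtype
  obtain ⟨p, hp, hC⟩ := exists_eq_zpowers_exp (M.comap rotZ)
  refine ⟨p, hp, ?_, fun A hA h1 h2 => ?_⟩
  · rw [zeta_eq_rotZ, ← Subgroup.mem_comap, hC]; exact Subgroup.mem_zpowers _
  · obtain ⟨z, rfl⟩ := exists_eq_rotZ h1 h2
    rw [← Subgroup.mem_comap, hC] at hA
    rw [zeta_eq_rotZ, ← MonoidHom.map_zpowers]
    exact Subgroup.mem_map_of_mem _ hA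

/-- An axial element of determinant -1 becomes a rotation about e₃ after multiplication by the
mirror. -/
theorem mem_of_axial {H : Subgroup O3} {p : ℕ} (hmir : mirror ∈ M)
    (hrot : ∀ A ∈ M, spaceAct A e₃ = e₃ → spaceDet A = 1 → A ∈ Subgroup.zpowers (zeta p))
    (hz : zeta p ∈ H) (hm : mirror ∈ H) {A : O3} (hA : A ∈ M) (hax : A ∈ axialGroup e₃) :
    A ∈ H := by
  have key : ∀ B ∈ M, spaceAct B e₃ = e₃ → spaceDet B = 1 → B ∈ H := fun B hB h1 h2 =>
    (Subgroup.zpowers_le.2 hz) (hrot B hB h1 h2)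
  rw [mem_axialGroup] at hax
  rcases spaceDet_eq A with hd | hd
  · exact key A hA (by rw [hax, hd, one_smul]) hd
  · have h1 : mirror * A ∈ H := by
      refine key _ (mul_mem hmir hA) ?_ ?_
      · rw [spaceAct_mul, hax, hd, neg_smul, one_smul, spaceAct_neg, spaceAct_mirror_e₃, neg_neg]
      · rw [spaceDet_mul, spaceDet_mirror, hd]; norm_num
    have h2 : A = mirror * (mirror * A) := by rw [← mul_assoc, mirror_mul_self, one_mul]
    rw [h2]; exact mul_mem hm h1

theorem eq_groupCph (hfin : (M : Set O3).Finite) (hmir : mirror ∈ M) (hax : M ≤ axialGroup e₃) :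
    ∃ p, 1 ≤ p ∧ M = groupCph p := by
  obtain ⟨p, hp, hz, hrot⟩ := exists_rotations_eq hfin
  refine ⟨p, Nat.one_le_iff_ne_zero.2 hp, le_antisymm (fun A hA => ?_)
    ((groupCph_le_iff hp M).2 ⟨hz, hmir⟩)⟩
  obtain ⟨h1, h2⟩ := (groupCph_le_iff hp (groupCph p)).1 le_rfl
  exact mem_of_axial hmir hrot h1 h2 hA (hax hA)

/-- Multiplying a non-axial element by κ makes it axial, so ζ_p, the mirror and κ generate M; the
parity of p then selects the family. -/
theorem eq_dihedral (hfin : (M : Set O3).Finite) (hmir : mirror ∈ M) (hkap : kappa ∈ M)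
    (hline : ∀ A ∈ M, spaceAct A e₃ = e₃ ∨ spaceAct A e₃ = -e₃) :
    (∃ p, 2 ≤ p ∧ Even p ∧ M = groupIDp p) ∨ ∃ p, 1 ≤ p ∧ M = groupD2pDp p := by
  obtain ⟨p, hp, hz, hrot⟩ := exists_rotations_eq hfin
  have key : ∀ H : Subgroup O3, zeta p ∈ H ∧ mirror ∈ H ∧ kappa ∈ H → M ≤ H := by
    rintro H ⟨h1, h2, h3⟩ A hA
    by_cases hax : A ∈ axialGroup e₃
    · exact mem_of_axial hmir hrot h1 h2 hA hax
    · have h4 : kappa * A ∈ H := by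
        refine mem_of_axial hmir hrot h1 h2 (mul_mem hkap hA) ?_
        rw [mem_axialGroup] at hax ⊢
        rw [spaceDet_mul, spaceDet_kappa, one_mul, spaceAct_mul]
        rcases hline A hA with h | h <;> rcases spaceDet_eq A with hd | hd <;>
          rw [h, hd] at hax ⊢ <;>
          simp [spaceAct_neg, spaceAct_kappa_e₃] at hax ⊢
      have h5 : A = kappa * (kappa * A) := by rw [← mul_assoc, kappa_mul_self, one_mul]
      rw [h5]; exact mul_mem h3 h4
  rcases Nat.even_or_odd p with he | ho
  · refine Or.inl ⟨p, ?_, he, le_antisymm (key _ ((groupIDp_le_iff hp he _).1 le_rfl))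
      ((groupIDp_le_iff hp he M).2 ⟨hz, hmir, hkap⟩)⟩
    obtain ⟨q, rfl⟩ := he.two_dvd
    omega
  · exact Or.inr ⟨p, ho.pos, le_antisymm (key _ ((groupD2pDp_le_iff ho _).1 le_rfl))
      ((groupD2pDp_le_iff ho M).2 ⟨hz, hmir, hkap⟩)⟩

theorem map_conj_comap (a : O3) (M : Subgroup O3) :
    (M.comap (MulAut.conj a).toMonoidHom).map (MulAut.conj a).toMonoidHom = M :=
  Subgroup.map_comap_eq_self_of_surjective (MulAut.conj a).surjective M

theorem mem_comap_conj {a A : O3} : A ∈ M.comap (MulAut.conj a).toMonoidHom ↔ a * A * a⁻¹ ∈ M :=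
  Iff.rfl

theorem finite_comap_conj (a : O3) (hfin : (M : Set O3).Finite) :
    (M.comap (MulAut.conj a).toMonoidHom : Set O3).Finite :=
  hfin.preimage (f := MulAut.conj a) (MulAut.conj a).injective.injOn

/-- Up to conjugacy, a finite group with the reflection along an invariant plane is of prism or of
dihedral type. -/
theorem exists_eq_map_conj (hfin : (M : Set O3).Finite) (hmir : mirror ∈ M)
    (hline : ∀ A ∈ M, spaceAct A e₃ = e₃ ∨ spaceAct A e₃ = -e₃) :
    ∃ a : O3, (∃ p, 1 ≤ p ∧ M = (groupCph p).map (MulAut.conj a).toMonoidHom) ∨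
      (∃ p, 2 ≤ p ∧ Even p ∧ M = (groupIDp p).map (MulAut.conj a).toMonoidHom) ∨
      ∃ p, 1 ≤ p ∧ M = (groupD2pDp p).map (MulAut.conj a).toMonoidHom := by
  by_cases hax : M ≤ axialGroup e₃
  · obtain ⟨p, hp, h⟩ := eq_groupCph hfin hmir hax
    refine ⟨1, Or.inl ⟨p, hp, ?_⟩⟩
    rw [map_one, h]; exact (Subgroup.map_id _).symm
  obtain ⟨A, hA, hAe, hd⟩ : ∃ A ∈ M, spaceAct A e₃ = -e₃ ∧ spaceDet A = 1 := by
    obtain ⟨A, hA, hAx⟩ := Set.not_subset.1 hax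
    rw [SetLike.mem_coe, mem_axialGroup] at hAx
    rcases hline A hA with h | h <;> rcases spaceDet_eq A with hd | hd <;> rw [h, hd] at hAx
    · simp at hAx
    · refine ⟨mirror * A, mul_mem hmir hA, ?_, ?_⟩
      · rw [spaceAct_mul, h, spaceAct_mirror_e₃]
      · rw [spaceDet_mul, spaceDet_mirror, hd]; norm_num
    · exact ⟨A, hA, h, hd⟩
    · simp at hAx
  -- A is a half-turn about a horizontal axis. As κ inverts rotations about e₃, conjugating κ by a
  -- square root w of z = Aκ gives A.
  obtain ⟨z, hz⟩ : ∃ z, A * kappa = rotZ z := by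
    refine exists_eq_rotZ ?_ ?_
    · rw [spaceAct_mul, spaceAct_kappa_e₃, spaceAct_neg, hAe, neg_neg]
    · rw [spaceDet_mul, hd, spaceDet_kappa, one_mul]
  obtain ⟨w, rfl⟩ : ∃ w : Circle, w * w = z :=
    ⟨Circle.exp (Complex.arg z / 2), by rw [← Circle.exp_add, add_halves, Circle.exp_arg]⟩
  have hAw : rotZ w * kappa * (rotZ w)⁻¹ = A := by
    rw [← map_inv, mul_assoc, kappa_mul_rotZ, inv_inv, ← mul_assoc, ← map_mul, ← hz, mul_assoc,
      kappa_mul_self, mul_one]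
  have hrote : ∀ u : Circle, spaceAct (rotZ u) e₃ = e₃ := fun u => by
    apply space_ext <;> simp [spaceAct_apply, rotZ, e₃]
  have h := eq_dihedral (finite_comap_conj (rotZ w) hfin) (mem_comap_conj.2 ?_)
    (mem_comap_conj.2 (by rw [hAw]; exact hA)) ?_
  · refine ⟨rotZ w, Or.inr ?_⟩
    rcases h with ⟨p, hp, he, h⟩ | ⟨p, hp, h⟩
    · exact Or.inl ⟨p, hp, he, by rw [← h, map_conj_comap]⟩
    · exact Or.inr ⟨p, hp, by rw [← h, map_conj_comap]⟩
  · rw [← mirror_mul_rotZ, mul_inv_cancel_right]; exact hmir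
  · intro B hB
    have h1 : spaceAct B e₃ = spaceAct (rotZ w⁻¹) (spaceAct (rotZ w * B * (rotZ w)⁻¹) e₃) := by
      rw [← spaceAct_mul, ← map_inv, ← mul_assoc, ← mul_assoc, ← map_mul, inv_mul_cancel, map_one,
        one_mul, spaceAct_mul, hrote]
    rw [h1]
    rcases hline _ (mem_comap_conj.1 hB) with h | h <;> rw [h]
    · left; exact hrote _
    · right; rw [spaceAct_neg, hrote]

end Classification

/-- Every direction is the image of the third axis. -/
theorem exists_spaceAct_e₃_eq {w : Space} (hw : w ≠ 0) :
    ∃ (a : O3) (c : ℝ), c ≠ 0 ∧ spaceAct a e₃ = c • w := by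
  have hunit : ∀ v : Space, v ≠ 0 → inner ℝ (‖v‖⁻¹ • v) (‖v‖⁻¹ • v) = (1 : ℝ) := fun v hv => by
    rw [real_inner_self_eq_norm_sq, norm_smul, norm_inv, norm_norm,
      inv_mul_cancel₀ (norm_ne_zero_iff.2 hv), one_pow]
  obtain ⟨a', ha', hwa'⟩ := exists_orthogonal_ne_zero w
  set u : Space := ‖w‖⁻¹ • w with hu
  set a : Space := ‖a'‖⁻¹ • a' with ha
  have huu : inner ℝ u u = (1 : ℝ) := hunit w hw
  have haa : inner ℝ a a = (1 : ℝ) := hunit a' ha'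
  have hua : inner ℝ u a = (0 : ℝ) := by
    rw [hu, ha, real_inner_smul_left, real_inner_smul_right, hwa', mul_zero, mul_zero]
  have hub := inner_omegaCross_left u a
  have hab := inner_omegaCross_right u a
  have hbb : inner ℝ (omegaCross u a) (omegaCross u a) = (1 : ℝ) := by
    have h : (inner ℝ (omegaCross u a) (omegaCross u a) : ℝ) =
        inner ℝ u u * inner ℝ a a - inner ℝ u a * inner ℝ u a := by
      simp only [inner_eq, omegaCross_apply_zero, omegaCross_apply_one, omegaCross_apply_two]
      ring
    rw [h, huu, haa, hua]; norm_num
  set b := omegaCross u a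
  rw [inner_eq] at huu haa hua hub hab hbb
  -- The columns are the orthonormal vectors a, u × a, u; the last is the image of e₃.
  refine ⟨⟨!![a 0, b 0, u 0; a 1, b 1, u 1; a 2, b 2, u 2], ?_⟩, ‖w‖⁻¹,
    inv_ne_zero (norm_ne_zero_iff.2 hw), ?_⟩
  · rw [Matrix.mem_orthogonalGroup_iff']
    ext i j
    fin_cases i <;> fin_cases j <;>
      simp [Matrix.mul_apply, Fin.sum_univ_three] <;> linarith
  · rw [← hu]
    apply space_ext <;> simp [spaceAct_apply, e₃]

/-! ### The space type of the core -/

section Groups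

variable {T : ℝ} {n : ℕ} {G : Subgroup (FullGroup T n)}

/-- Core elements with the same permutation differ by an element of K ∩ H_i, so each of the finitely
many permutations contributes at most two space parts. -/
theorem finite_map_rho {i : Fin n} {s : FullGroup T n}
    (hs : core G ⊓ isotropy G i = Subgroup.zpowers s) (hss : rho s * rho s = 1) :
    ((core G).map rho : Set O3).Finite := by
  have h : ((core G).map rho : Set O3) ⊆
      ⋃ π : Equiv.Perm (Fin n), rho '' {g | g ∈ core G ∧ sigma g = π} := by
    rintro _ ⟨g, hg, rfl⟩
    exact Set.mem_iUnion.2 ⟨sigma g, g, ⟨hg, rfl⟩, rfl⟩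
  refine (Set.finite_iUnion fun π => ?_).subset h
  rcases Set.eq_empty_or_nonempty {g : FullGroup T n | g ∈ core G ∧ sigma g = π} with h0 | ⟨k, hk⟩
  · rw [h0, Set.image_empty]; exact Set.finite_empty
  refine (Set.toFinite {rho k, rho s * rho k}).subset ?_
  rintro _ ⟨g, hg, rfl⟩
  have hgk : g * k⁻¹ ∈ core G ⊓ isotropy G i := by
    have h1 : g * k⁻¹ ∈ core G := mul_mem hg.1 (inv_mem hk.1)
    refine ⟨h1, (mem_core.1 h1).1, ?_⟩
    change sigma (g * k⁻¹) i = i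
    rw [map_mul, map_inv, hg.2, hk.2, mul_inv_cancel, Equiv.Perm.one_apply]
  rw [hs] at hgk
  rcases rho_eq_of_mem_zpowers hss hgk with h1 | h1 <;>
    rw [map_mul, map_inv, mul_inv_eq_iff_eq_mul] at h1
  · left; rw [h1, one_mul]
  · right; exact h1

/-- Conjugation by Q makes the plane horizontal, where `exists_eq_map_conj` applies. The family
D_pC_p is never needed: the other three already cover every case. -/
theorem isType_of_leavesInvariant {i : Fin n} {s : FullGroup T n} {w : Space}
    (hs : core G ⊓ isotropy G i = Subgroup.zpowers s) (hw : IsReflectionAlong (rho s) w)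
    (hP : LeavesInvariant (core G) (ℝ ∙ w)ᗮ) : IsTypeCph (core G) ∨ IsDihedralType (core G) := by
  have hsc : s ∈ core G := (hs ▸ Subgroup.mem_zpowers s : s ∈ core G ⊓ isotropy G i).1
  obtain ⟨Q, c, hc, hQ⟩ := exists_spaceAct_e₃_eq hw.1
  have key := exists_eq_map_conj (M := ((core G).map rho).comap (MulAut.conj Q).toMonoidHom)
    (finite_comap_conj Q (finite_map_rho hs hw.mul_self)) ?_ ?_
  · obtain ⟨a, h⟩ := key
    have tr : ∀ F : Subgroup O3, ((core G).map rho).comap (MulAut.conj Q).toMonoidHom =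
        F.map (MulAut.conj a).toMonoidHom → HasSpaceType (core G) F := by
      intro F hF
      refine ⟨Q * a, ?_⟩
      rw [← map_conj_comap Q ((core G).map rho), hF, Subgroup.map_map, map_mul]
      rfl
    rcases h with ⟨p, hp, h⟩ | ⟨p, hp, he, h⟩ | ⟨p, hp, h⟩
    · exact Or.inl ⟨p, hp, tr _ h⟩
    · exact Or.inr (Or.inl ⟨p, hp, he, tr _ h⟩)
    · exact Or.inr (Or.inr (Or.inr ⟨p, hp, tr _ h⟩))
  · have h1 : rho s = Q * mirror * Q⁻¹ := by
      refine (hw.smul hc).eq ?_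
      rw [← hQ]; exact isReflectionAlong_mirror.conj Q
    rw [mem_comap_conj, ← h1]
    exact Subgroup.mem_map_of_mem rho hsc
  · intro A hA
    obtain ⟨k, hk, hkA⟩ := mem_comap_conj.1 hA
    obtain ⟨d, hd⟩ := eq_smul_of_omegaCross_eq_zero hw.1 (omegaCross_eq_zero_of_leavesInvariant hP hk)
    have h1 : spaceAct A e₃ = d • e₃ := by
      have h2 : spaceAct (Q * A * Q⁻¹) (spaceAct Q e₃) = d • spaceAct Q e₃ := by
        rw [← hkA, hQ, spaceAct_smul, hd, smul_comm]
      rw [spaceAct_mul, spaceAct_mul, spaceAct_inv_act, ← spaceAct_smul] at h2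
      rw [← spaceAct_inv_act Q (spaceAct A e₃), h2, spaceAct_inv_act]
    have h3 : |d| = 1 := by
      have := spaceAct_norm A e₃
      rw [h1, norm_smul, Real.norm_eq_abs] at this
      exact mul_right_cancel₀ (norm_ne_zero_iff.2 e₃_ne_zero) (this.trans (one_mul _).symm)
    rcases (abs_eq zero_le_one).1 h3 with rfl | rfl
    · left; rw [h1, one_smul]
    · right; rw [h1, neg_smul, one_smul]

end Groups

end NBody

/-! ### The main theorem -/

theorem mainTheorem5 {T : ℝ} [Fact (0 < T)] {n : ℕ}
    (m : Fin n → ℝ) (hm : ∀ i, 0 < m i) (α : ℝ) (hα : 0 < α)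
    (G : Subgroup (NBody.FullGroup T n))
    (hmass : ∀ g ∈ G, ∀ i, m (NBody.sigma g i) = m i)
    (htrans : NBody.IsTransitive G) (i : Fin n)
    (hcore : NBody.core G ≠ ⊥)
    (hrefl : ¬ ∃ P, NBody.GeneratedByReflection (NBody.core G) P) :
    -- one and only one of the three cases
    (¬ NBody.BoundToCollision G → ¬ NBody.FullyUncoercive m α G →
      ((NBody.core G ⊓ NBody.isotropy G i = ⊥ ∨
        (∃ P, NBody.GeneratedByReflection (NBody.core G ⊓ NBody.isotropy G i) P) ∨
        NBody.core G ⊓ NBody.isotropy G i = NBody.core G) ∧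
      ¬ (NBody.core G ⊓ NBody.isotropy G i = ⊥ ∧
        ∃ P, NBody.GeneratedByReflection (NBody.core G ⊓ NBody.isotropy G i) P) ∧
      ¬ (NBody.core G ⊓ NBody.isotropy G i = ⊥ ∧
        NBody.core G ⊓ NBody.isotropy G i = NBody.core G) ∧
      ¬ ((∃ P, NBody.GeneratedByReflection (NBody.core G ⊓ NBody.isotropy G i) P) ∧
        NBody.core G ⊓ NBody.isotropy G i = NBody.core G))) ∧
    -- the reflection case
    (∀ P, NBody.GeneratedByReflection (NBody.core G ⊓ NBody.isotropy G i) P →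
      (NBody.LeavesInvariant (NBody.core G) P →
        NBody.IsTypeCph (NBody.core G) ∨ NBody.IsDihedralType (NBody.core G)) ∧
      (¬ NBody.LeavesInvariant (NBody.core G) P →
        NBody.BoundToCollision G ∨ NBody.FullyUncoercive m α G) ∧
      (NBody.IsDihedralType (NBody.core G) →
        (∀ v, ¬ NBody.IsRotationAxis (NBody.core G) v ∧ ¬ NBody.IsRotationAxis G v) ∧
        (NBody.BoundToCollision G ∨ NBody.FullyUncoercive m α G)) ∧
      (NBody.IsTypeCph (NBody.core G) →
        ∀ v ∈ Pᗮ, v ≠ 0 → NBody.IsRotationAxis (NBody.core G) v)) := by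

  refine ⟨fun hbound hunc => ⟨NBody.trichotomy hα htrans i hbound hunc, ?_, ?_, ?_⟩,
    fun P hP => ?_⟩
  · rintro ⟨h, P, hP⟩
    exact hP.ne_bot h
  · rintro ⟨h1, h2⟩
    exact hcore (h2.symm.trans h1)
  · rintro ⟨⟨P, hP⟩, h⟩
    exact hrefl ⟨P, h ▸ hP⟩
  obtain ⟨s, hsP, hs⟩ := hP
  obtain ⟨w, rfl, hw⟩ := NBody.isPlaneReflection_iff.1 hsP
  have hsc : s ∈ NBody.core G :=
    (hs ▸ Subgroup.mem_zpowers s : s ∈ NBody.core G ⊓ NBody.isotropy G i).1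
  -- Either every equivariant loop collides, or a collisionless one is available as input for the
  -- criteria above.
  have hcases : (∀ x : NBody.Loop T n, x.IsEquivariant G → ¬ x.HasCollision →
      NBody.FullyUncoercive m α G) → NBody.BoundToCollision G ∨ NBody.FullyUncoercive m α G := by
    intro h
    by_contra hc
    rw [not_or] at hc
    simp only [NBody.BoundToCollision, not_forall] at hc
    obtain ⟨⟨x, hx, hcol⟩, hun⟩ := hc
    exact hun (h x hx hcol)
  refine ⟨NBody.isType_of_leavesInvariant hs hw, fun hP => hcases fun x hx hcol => ?_,
    fun hD => ⟨fun v => ?_, hcases fun x hx hcol => ?_⟩, fun hC v hv hv0 => ?_⟩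
  · obtain ⟨k, hk, hwk⟩ := NBody.exists_omegaCross_ne_zero hP
    exact NBody.fullyUncoercive_of_omegaCross_ne_zero hα hx hcol hs hw hk hwk
  · have := NBody.not_isRotationAxis_of_isDihedralType hD v
    exact ⟨this, fun h => this h.core⟩
  · exact NBody.fullyUncoercive_of_not_isRotationAxis hα hx hcol hs hw
      (NBody.not_isRotationAxis_of_isDihedralType hD w)
  · rw [Submodule.orthogonal_orthogonal] at hv
    obtain ⟨c, rfl⟩ := Submodule.mem_span_singleton.1 hv
    exact NBody.isRotationAxis_of_isTypeCph hC hsc hw fun h => hv0 (by rw [h, zero_smul])
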